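/- Let $A$ be a finite set of items and let $\mathcal F$ be an antimonotonic family of itemsets (subsets of $A$), i.e. every subset of a member of $\mathcal F$ is in $\mathcal F$. The dependency graph $G$ has vertex set $A$, and distinct items $x,y$ are adjacent iff $\{x,y\}\in\mathcal F$; "clique" means maximal clique of $G$. Assume that $G$ is connected, that $\mathcal F$ is triangulated (every circuit of $G$ of length at least $4$ has a chord), and that $\mathcal F$ is clique-safe (for every clique $V$ of $G$, every proper subset of $V$ is in $\mathcal F$). A distribution $p$ on $\{0,1\}^A$ satisfies $\theta=(\theta_U)_{U\in\mathcal F}$ if $p(z_i=1 \text{ for all } i\in U)=\theta_U$ for all $U\in\mathcal F$; frequencies for $\mathcal F$ are the vectors $\theta$ satisfied by at least one distribution. A set $C\subseteq A$ is safe if, for all frequencies $\theta$ for $\mathcal F$, every distribution on $\{0,1\}^C$ that satisfies $(\theta_U)_{U\in\mathcal F,\,U\subseteq C}$ is the marginal on $C$ of a distribution on $\{0,1\}^A$ satisfying $\theta$. The clique graph has the cliques of $G$ as vertices, two distinct cliques being adjacent iff they share an item. A junction tree is a spanning tree $T$ of the clique graph such that any item contained in two cliques is contained in every clique on the path of $T$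 between them. The edges of $T$ are called separators; the items of a separator are the items common to its two end cliques. Given $B\subseteq A$, choose for each $b\in B$ a clique $Q_b\ni b$ so that the number of edges of $T$ lying on the paths of $T$ between the chosen cliques is as small as possible; the edges on these paths are the inner separators of $B$ in $T$. Then for every $B\subseteq A$ there is a smallest safe set $C$ containing $B$ (it is contained in every safe set containing $B$, so it is the unique one with the minimal number of items), and there exists a junction tree $T$ (which may depend on $B$) such that, for every such minimal choice of cliques, $C$ consists precisely of the items of $B$ and the items of the inner separators of $B$ in $T$. -/

import Mathlib

namespace SafeProjection

open scoped BigOperators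

section Distributions

variable {ι : Type*} [Fintype ι] [DecidableEq ι]

/-- The itemset indicator `S_U(z)`: it is `1` if `z i = 1` for all `i ∈ U`, and `0` otherwise. -/
def indicator (U : Finset ι) (z : ι → Bool) : ℝ :=
  if ∀ i ∈ U, z i = true then 1 else 0

/-- The set of all probability distributions on the binary vectors indexed by `ι`. -/
def distributions (ι : Type*) [Fintype ι] [DecidableEq ι] : Set ((ι → Bool) → ℝ) :=
  stdSimplex ℝ (ι → Bool)

/-- The frequency of the itemset `U` under `p`, i.e. the mean of `S_U` with respect to `p`. -/
def frequency (p : (ι → Bool) → ℝ) (U : Finset ι) : ℝ :=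
  ∑ z, p z * indicator U z

/-- `p` satisfies the frequencies `θ` of the family `F`
(only the values of `θ` on members of `F` matter). -/
def Satisfies (F : Set (Finset ι)) (θ : Finset ι → ℝ) (p : (ι → Bool) → ℝ) : Prop :=
  ∀ U ∈ F, frequency p U = θ U

/-- `θ` is a vector of frequencies for `F`: it comes from some distribution. -/
def IsFrequencyVector (F : Set (Finset ι)) (θ : Finset ι → ℝ) : Prop :=
  ∃ p ∈ distributions ι, Satisfies F θ p

end Distributions

section Safe

variable {A : Type*} [Fintype A] [DecidableEq A]

/-- An itemset over the items of `C`, seen as an itemset over all items. -/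
def lift (C : Finset A) (V : Finset C) : Finset A :=
  V.map (Function.Embedding.subtype (· ∈ C))

/-- The projected family: the members of `F` that are subsets of `C`. -/
def projFamily (C : Finset A) (F : Set (Finset A)) : Set (Finset C) :=
  {V | lift C V ∈ F}

/-- The projected frequencies. -/
def projFreq (C : Finset A) (θ : Finset A → ℝ) : Finset C → ℝ :=
  fun V => θ (lift C V)

/-- The marginalisation of `p` to `C`. -/
def marginal (C : Finset A) (p : (A → Bool) → ℝ) : (C → Bool) → ℝ :=
  fun y => ∑ z : A → Bool with (fun a : C => z a) = y, p z

/-- `C` is `θ`-safe: each distribution on `C` that satisfies the projected frequencies has an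
extension to all items that satisfies `θ`. -/
def IsSafeFor (F : Set (Finset A)) (θ : Finset A → ℝ) (C : Finset A) : Prop :=
  ∀ q ∈ distributions C, Satisfies (projFamily C F) (projFreq C θ) q →
    ∃ p ∈ distributions A, marginal C p = q ∧ Satisfies F θ p

/-- `C` is safe: it is `θ`-safe for all frequencies `θ` for `F`. -/
def IsSafe (F : Set (Finset A)) (C : Finset A) : Prop :=
  ∀ θ : Finset A → ℝ, IsFrequencyVector F θ → IsSafeFor F θ C

/-- `C` is the minimal safe set containing `B`: it is safe, it contains `B`, and it is contained in
every safe set containing `B`. In particular it is the unique safe set containing `B` with the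
smallest possible number of items. -/
def IsMinimalSafe (F : Set (Finset A)) (B C : Finset A) : Prop :=
  IsLeast {Y : Finset A | B ⊆ Y ∧ IsSafe F Y} C

end Safe

section Graphs

variable {A : Type*} [DecidableEq A]

/-- The dependency graph: distinct items `x`, `y` are adjacent if `{x, y} ∈ F`. -/
def dependencyGraph (F : Set (Finset A)) : SimpleGraph A where
  Adj x y := x ≠ y ∧ ({x, y} : Finset A) ∈ F
  symm := ⟨fun x y h => ⟨h.1.symm, by rw [Finset.pair_comm]; exact h.2⟩⟩
  loopless := ⟨fun _ h => h.1 rfl⟩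

/-- Every circuit of length at least `4` has a chord. -/
def IsTriangulated (G : SimpleGraph A) : Prop :=
  ∀ (v : A) (c : G.Walk v v), c.IsCycle → 4 ≤ c.length →
    ∃ x ∈ c.support, ∃ y ∈ c.support, G.Adj x y ∧ s(x, y) ∉ c.edges

/-- The (maximal) cliques of `G`. -/
abbrev MaxClique (G : SimpleGraph A) : Type _ :=
  {Q : Finset A // Maximal (fun s : Finset A => G.IsClique (s : Set A)) Q}

/-- `F` is clique-safe: each proper subset of each clique of the dependency graph is in `F`. -/
def IsCliqueSafe (F : Set (Finset A)) : Prop :=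
  ∀ Q : MaxClique (dependencyGraph F), ∀ U : Finset A, U ⊂ Q.1 → U ∈ F

/-- The clique graph: distinct cliques are adjacent if they share an item. -/
def cliqueGraph (G : SimpleGraph A) : SimpleGraph (MaxClique G) where
  Adj Q R := Q ≠ R ∧ (Q.1 ∩ R.1).Nonempty
  symm := ⟨fun Q R h => ⟨h.1.symm, by rw [Finset.inter_comm]; exact h.2⟩⟩
  loopless := ⟨fun _ h => h.1 rfl⟩

/-- A junction tree: a spanning tree of the clique graph with the running intersection property. -/
structure IsJunctionTree (G : SimpleGraph A) (T : SimpleGraph (MaxClique G)) : Prop where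
  le_cliqueGraph : T ≤ cliqueGraph G
  isTree : T.IsTree
  running_intersection : ∀ (Q R : MaxClique G) (w : T.Walk Q R), w.IsPath →
    ∀ x, x ∈ Q.1 → x ∈ R.1 → ∀ S ∈ w.support, x ∈ S.1

variable {G : SimpleGraph A}

/-- A choice of cliques for the items of `B`: the clique of `b` contains `b`. -/
def IsCliqueChoice (B : Finset A) (Q : B → MaxClique G) : Prop :=
  ∀ b : B, b.1 ∈ (Q b).1

/-- The separators (edges of `T`) on the paths in `T` between the chosen cliques. -/
def pathSeparators (T : SimpleGraph (MaxClique G)) {B : Finset A} (Q : B → MaxClique G) :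
    Set (Sym2 (MaxClique G)) :=
  {e | ∃ (b c : B) (w : T.Walk (Q b) (Q c)), w.IsPath ∧ e ∈ w.edges}

/-- A choice of cliques for which the number of separators on the paths is smallest possible.
The inner separators of `B` are `pathSeparators T Q` for such a choice. -/
def IsOptimalChoice (T : SimpleGraph (MaxClique G)) (B : Finset A) (Q : B → MaxClique G) : Prop :=
  IsCliqueChoice B Q ∧ ∀ Q' : B → MaxClique G, IsCliqueChoice B Q' →
    (pathSeparators T Q).ncard ≤ (pathSeparators T Q').ncard

/-- The items of a set of separators: the items mutual to both ends of one of the separators. -/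
def separatorItems (E : Set (Sym2 (MaxClique G))) : Set A :=
  {x | ∃ e ∈ E, ∀ S ∈ e, x ∈ S.1}

/-- Optimal choices of cliques always exist. -/
theorem exists_isOptimalChoice [Finite A] (T : SimpleGraph (MaxClique G)) (B : Finset A) :
    ∃ Q : B → MaxClique G, IsOptimalChoice T B Q := by
  have h : ∀ b : B, ∃ Q : MaxClique G, b.1 ∈ Q.1 := by
    intro b
    obtain ⟨Q, hb, hQ⟩ := Finite.exists_le_maximal
      (p := fun s : Finset A => G.IsClique (s : Set A)) (a := {b.1}) (by simp)
    exact ⟨⟨Q, hQ⟩, hb (Finset.mem_singleton_self _)⟩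
  choose Q₀ hQ₀ using h
  obtain ⟨Q, hQ, hmin⟩ := (measure fun Q : B → MaxClique G => (pathSeparators T Q).ncard).wf.has_min
    {Q | IsCliqueChoice B Q} ⟨Q₀, hQ₀⟩
  exact ⟨Q, hQ, fun Q' hQ' => not_lt.mp (hmin Q' hQ')⟩

end Graphs

end SafeProjection

open SafeProjection

/-! Call `C` convex if, for each connected component of the complement of `C` in the dependency
graph, the vertices of `C` adjacent to that component (its attachment) form a clique. The proof
shows that safe means convex, and that for a suitable junction tree the items of `B` and of its
inner separators form the least convex set containing `B`.

Both sides use one fact about triangulated graphs, `IsTriangulated.exists_adj_attachment`: if `C` is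
convex, every component of its complement has a vertex adjacent to its whole attachment. So the
attachment plus that vertex is a clique, and `C` can be enlarged by this vertex, or by a maximal
clique containing it and the attachment, while staying convex.

Convex implies safe (`exists_extension_of_isConvex`): add such vertices one at a time. The
attachment is a proper subset of a maximal clique, so clique-safety puts it in `F`, its frequencies
are known, and the new value can be drawn from the conditional law of a reference distribution. Safe
implies convex (`isConvex_of_isSafe`): two nonadjacent vertices attached to one component can be
forced to be equal by frequencies outside `C`, although the frequencies inside `C` allow them to
exclude each other.

On the tree side, the separator of a junction tree edge separates the items on its two sides, so `B`
with the separator items is convex for every choice of cliques. Conversely, if a separator has an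
item outside a convex `C` containing `B`, rehanging the tree at one clique strictly lowers the
number of path separators (`IsJunctionTree.exists_fewer_pathSeparators`). A tree and choice with the
globally smallest number therefore give the least convex set. -/

namespace SafeProjection

/-! ### Convex vertex sets and attachments of components -/

section Convexity

variable {A : Type*} {G : SimpleGraph A}

/-- The edges of `G` with both ends in `X`, as a graph on all vertices. -/
def restrict (G : SimpleGraph A) (X : Set A) : SimpleGraph A where
  Adj u v := G.Adj u v ∧ u ∈ X ∧ v ∈ X
  symm := ⟨fun _ _ h => ⟨h.1.symm, h.2.2, h.2.1⟩⟩
  loopless := ⟨fun _ h => G.loopless.irrefl _ h.1⟩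

theorem restrict_le (X : Set A) : restrict G X ≤ G := fun _ _ h => h.1

theorem mem_of_mem_support_restrict {X : Set A} {u v : A} (p : (restrict G X).Walk u v)
    (hu : u ∈ X) : ∀ x ∈ p.support, x ∈ X := by
  induction p with
  | nil => simpa using hu
  | cons h p ih =>
    intro x hx
    rw [SimpleGraph.Walk.support_cons, List.mem_cons] at hx
    rcases hx with rfl | hx
    · exact hu
    · exact ih h.2.2 x hx

theorem mem_of_reachable_restrict {X : Set A} {u v : A} (h : (restrict G X).Reachable u v)
    (hu : u ∈ X) : v ∈ X := by
  obtain ⟨p⟩ := h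
  exact mem_of_mem_support_restrict p hu v p.end_mem_support

/-- A walk can be carried over to the restriction to any set containing its vertices. -/
theorem reachable_restrict_of_walk {H : SimpleGraph A} (hH : H ≤ G) {X : Set A} {u v : A}
    (p : H.Walk u v) (hX : ∀ x ∈ p.support, x ∈ X) : (restrict G X).Reachable u v := by
  induction p with
  | nil => exact SimpleGraph.Reachable.refl _
  | cons h p ih =>
    have hp : ∀ x ∈ p.support, x ∈ X := fun x hx => hX x (by simp [hx])
    have hadj : (restrict G X).Adj _ _ :=
      ⟨hH h, hX _ (by simp), hp _ p.start_mem_support⟩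
    exact hadj.reachable.trans (ih hp)

/-- `C` is convex if distinct vertices of `C` attached to the same component of the complement
of `C` are adjacent. -/
def IsConvex (G : SimpleGraph A) (C : Set A) : Prop :=
  ∀ ⦃x y u v : A⦄, x ∈ C → y ∈ C → u ∉ C → v ∉ C → G.Adj x u → G.Adj y v →
    (restrict G Cᶜ).Reachable u v → x ≠ y → G.Adj x y

/-- The vertices of `C` with a neighbour in the component of `w` in the complement of `C`. -/
def attachment (G : SimpleGraph A) (C : Set A) (w : A) : Set A :=
  {x | x ∈ C ∧ ∃ u, (restrict G Cᶜ).Reachable w u ∧ G.Adj x u}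

theorem IsConvex.isClique_attachment {C : Set A} (hC : IsConvex G C) {w : A} (hw : w ∉ C) :
    G.IsClique (attachment G C w) := by
  rintro x ⟨hx, u, hu, hxu⟩ y ⟨hy, v, hv, hyv⟩ hne
  exact hC hx hy (mem_of_reachable_restrict hu hw) (mem_of_reachable_restrict hv hw) hxu hyv
    (hu.symm.trans hv) hne

theorem attachment_congr {C : Set A} {w w' : A} (h : (restrict G Cᶜ).Reachable w w') :
    attachment G C w = attachment G C w' := by
  ext x
  exact ⟨fun ⟨hx, u, hu, hxu⟩ => ⟨hx, u, h.symm.trans hu, hxu⟩,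
    fun ⟨hx, u, hu, hxu⟩ => ⟨hx, u, h.trans hu, hxu⟩⟩

/-- A neighbour of a vertex outside `C` is attached to its component or lies in it. -/
theorem mem_attachment_or_reachable {C : Set A} {w u x : A} (hw : w ∉ C)
    (hu : (restrict G Cᶜ).Reachable w u) (hxu : G.Adj x u) :
    x ∈ attachment G C w ∨ (restrict G Cᶜ).Reachable w x := by
  by_cases hx : x ∈ C
  · exact Or.inl ⟨hx, u, hu, hxu⟩
  · have hadj : (restrict G Cᶜ).Adj u x := ⟨hxu.symm, mem_of_reachable_restrict hu hw, hx⟩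
    exact Or.inr (hu.trans hadj.reachable)

theorem clique_subset_attachment_union {C : Set A} {w u : A} (hw : w ∉ C)
    (hu : (restrict G Cᶜ).Reachable w u) {s : Set A} (hs : G.IsClique s) (hus : u ∈ s) :
    ∀ x ∈ s, x ∈ attachment G C w ∨ (restrict G Cᶜ).Reachable w x := by
  intro x hx
  by_cases h : x = u
  · exact Or.inr (h ▸ hu)
  · exact mem_attachment_or_reachable hw hu (hs hx hus h)

/-- A component of the complement of `C ∪ Y` lies in a component of the complement of `C`. If that
is the component of `w`, everything attached lies in the clique `Y`. If it is another one, no vertex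
of `Y` outside `C` can be attached, and convexity of `C` applies. -/
theorem IsConvex.union_clique {C : Set A} (hC : IsConvex G C) {w : A} (hw : w ∉ C) {Y : Set A}
    (hY : G.IsClique Y) (hKY : attachment G C w ⊆ Y)
    (hYW : ∀ y ∈ Y, y ∈ attachment G C w ∨ (restrict G Cᶜ).Reachable w y) :
    IsConvex G (C ∪ Y) := by
  have key : ∀ {x y u v : A}, x ∈ C ∪ Y → y ∈ C ∪ Y → u ∉ C ∪ Y → v ∉ C ∪ Y → G.Adj x u →
      G.Adj y v → (restrict G Cᶜ).Reachable u v → (restrict G Cᶜ).Reachable w u → y ∈ Y := by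
    intro x y u v _ hy _ _ _ hyv huv hwu
    rcases hy with hy | hy
    · exact hKY ⟨hy, v, hwu.trans huv, hyv⟩
    · exact hy
  have mem : ∀ {x u : A}, x ∈ C ∪ Y → u ∉ C ∪ Y → G.Adj x u →
      ¬ (restrict G Cᶜ).Reachable w u → x ∈ C := by
    intro x u hx hu hxu hwu
    rcases hx with hx | hx
    · exact hx
    · rcases hYW x hx with h | h
      · exact h.1
      · have hadj : (restrict G Cᶜ).Adj x u :=
          ⟨hxu, mem_of_reachable_restrict h hw, fun h' => hu (Or.inl h')⟩
        exact absurd (h.trans hadj.reachable) hwu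
  intro x y u v hx hy hu hv hxu hyv huv hne
  have huv' : (restrict G Cᶜ).Reachable u v := by
    obtain ⟨p⟩ := huv
    exact reachable_restrict_of_walk (restrict_le _) p fun z hz h =>
      mem_of_mem_support_restrict p hu z hz (Or.inl h)
  by_cases hwu : (restrict G Cᶜ).Reachable w u
  · exact hY (key hy hx hv hu hyv hxu huv'.symm (hwu.trans huv'))
      (key hx hy hu hv hxu hyv huv' hwu) hne
  · exact hC (mem hx hu hxu hwu) (mem hy hv hyv fun h => hwu (h.trans huv'.symm))
      (fun h => hu (Or.inl h)) (fun h => hv (Or.inl h)) hxu hyv huv' hne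

/-- A vertex of the clique outside `C` lies in the component of `w`, so all others are attached to
this component or lie in it. This is what glues `C` and `Y` along the attachment without creating
new cliques. -/
theorem clique_subset_or_subset_of_union {C : Set A} {w : A} (hw : w ∉ C) {Y : Set A}
    (hKY : attachment G C w ⊆ Y)
    (hYW : ∀ y ∈ Y, y ∈ attachment G C w ∨ (restrict G Cᶜ).Reachable w y)
    {s : Set A} (hs : G.IsClique s) (hsub : s ⊆ C ∪ Y) : s ⊆ C ∨ s ⊆ Y := by
  by_cases h : s ⊆ C
  · exact Or.inl h
  · obtain ⟨u, hu, huC⟩ := Set.not_subset.mp h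
    have huY : u ∈ Y := (hsub hu).resolve_left huC
    have hwu : (restrict G Cᶜ).Reachable w u := (hYW u huY).resolve_left fun h => huC h.1
    refine Or.inr fun x hx => ?_
    rcases clique_subset_attachment_union hw hwu hs hu x hx with h | h
    · exact hKY h
    · exact (hsub hx).resolve_left (mem_of_reachable_restrict h hw)

/-- With nothing attached, the component of `w` would absorb all neighbours, and a walk from `C` to
`w` would lie in it entirely. -/
theorem attachment_nonempty (hG : G.Connected) {C : Set A} (hCne : C.Nonempty) {w : A}
    (hw : w ∉ C) : (attachment G C w).Nonempty := by
  by_contra hK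
  rw [Set.not_nonempty_iff_eq_empty] at hK
  have key : ∀ {b c : A} (_ : G.Walk b c), (restrict G Cᶜ).Reachable w c →
      (restrict G Cᶜ).Reachable w b := by
    intro b c p
    induction p with
    | nil => exact id
    | cons hbc p ih =>
      exact fun hc => (mem_attachment_or_reachable hw (ih hc) hbc).resolve_left (by simp [hK])
  obtain ⟨a, ha⟩ := hCne
  obtain ⟨p⟩ := hG.preconnected a w
  exact mem_of_reachable_restrict (key p (SimpleGraph.Reachable.refl _)) hw ha

end Convexity

/-! ### Dirac-type lemmas for triangulated graphs -/

section Triangulated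

variable {A : Type*} {G : SimpleGraph A}

/-- Adjacent vertices outside `X` with neighbours connected inside `X` have a common neighbour
in `X`. -/
theorem IsTriangulated.exists_common_neighbor [DecidableEq A] (hG : IsTriangulated G) {X : Set A}
    {k z a b : A} (hkz : G.Adj k z) (hk : k ∉ X) (hz : z ∉ X) (ha : a ∈ X) (hka : G.Adj k a)
    (hbz : G.Adj b z) (hab : (restrict G X).Reachable a b) :
    ∃ u ∈ X, G.Adj k u ∧ G.Adj u z := by
  classical
  -- Take a shortest walk in `X` from any neighbour of `k` to any neighbour of `z`. Length zero
  -- gives the common neighbour; otherwise closing it up through `z` and `k` gives a cycle of length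
  -- `p.length + 3`.
  have hex : ∃ n, ∃ a b, ∃ p : (restrict G X).Walk a b,
      a ∈ X ∧ G.Adj k a ∧ G.Adj b z ∧ p.length = n := by
    obtain ⟨p⟩ := hab
    exact ⟨_, a, b, p, ha, hka, hbz, rfl⟩
  obtain ⟨a, b, p, ha, hka, hbz, hp⟩ := Nat.find_spec hex
  have hmin : ∀ (a' b' : A) (p' : (restrict G X).Walk a' b'), a' ∈ X → G.Adj k a' → G.Adj b' z →
      p.length ≤ p'.length := fun a' b' p' h1 h2 h3 => by
    rw [hp]; exact Nat.find_min' hex ⟨a', b', p', h1, h2, h3, rfl⟩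
  clear hp hab
  have hpX := mem_of_mem_support_restrict p ha
  have hpath : p.IsPath := by
    have h := hmin a b p.bypass ha hka hbz
    have : p.bypass = p := SimpleGraph.Walk.bypass_eq_self_of_length_le_length_bypass _ h
    exact this ▸ p.bypass_isPath
  by_cases hlen : p.length = 0
  · obtain rfl := SimpleGraph.Walk.eq_of_length_eq_zero hlen
    exact ⟨a, ha, hka, hbz⟩
  exfalso
  set p' : G.Walk a b := p.mapLe (restrict_le X) with hp'
  have hsupp : p'.support = p.support := by simp [hp']
  have hedges : p'.edges = p.edges := by simp [hp']
  set q : G.Walk k z := SimpleGraph.Walk.cons hka (p'.concat hbz) with hq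
  have hkp : k ∉ p'.support := fun h => hk (hpX k (hsupp ▸ h))
  have hzp : z ∉ p'.support := fun h => hz (hpX z (hsupp ▸ h))
  have hp'path : p'.IsPath := by
    rw [SimpleGraph.Walk.isPath_def, hsupp]; exact hpath.support_nodup
  have hbX : b ∈ X := hpX b p.end_mem_support
  have hqpath : q.IsPath := by
    rw [hq, SimpleGraph.Walk.cons_isPath_iff]
    refine ⟨hp'path.concat hzp hbz, ?_⟩
    rw [SimpleGraph.Walk.support_concat]
    simp [hkp, hkz.ne]
  have hzk : s(z, k) ∉ q.edges := by
    rw [hq, SimpleGraph.Walk.edges_cons, SimpleGraph.Walk.edges_concat]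
    have h1 : z ≠ a := fun h => hz (h ▸ ha)
    have h2 : k ≠ b := fun h => hk (h ▸ hbX)
    have h3 : s(z, k) ∉ p'.edges := fun h => hzp (p'.fst_mem_support_of_mem_edges h)
    simp only [List.mem_cons, List.concat_eq_append, List.mem_append, Sym2.eq_iff]
    have := hkz.ne
    grind
  set c : G.Walk z z := SimpleGraph.Walk.cons hkz.symm q with hc
  have hcyc : c.IsCycle := (SimpleGraph.Walk.cons_isCycle_iff q hkz.symm).mpr ⟨hqpath, hzk⟩
  have hclen : 4 ≤ c.length := by
    have : p'.length = p.length := by simp [hp']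
    simp [hc, hq]; omega
  obtain ⟨x, hx, y, hy, hxy, hne⟩ := hG z c hcyc hclen
  have hcsupp : ∀ x, x ∈ c.support → x = z ∨ x = k ∨ x ∈ p.support := by
    intro x hx
    rw [hc, SimpleGraph.Walk.support_cons, hq, SimpleGraph.Walk.support_cons,
      SimpleGraph.Walk.support_concat, hsupp] at hx
    simp at hx; tauto
  have hcedges : ∀ e, e ∈ c.edges ↔ e = s(z, k) ∨ e = s(k, a) ∨ e ∈ p.edges ∨ e = s(b, z) := by
    intro e
    rw [hc, SimpleGraph.Walk.edges_cons, hq, SimpleGraph.Walk.edges_cons,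
      SimpleGraph.Walk.edges_concat, hedges]
    simp
  rw [hcedges] at hne
  push Not at hne
  obtain ⟨hne1, hne2, hne3, hne4⟩ := hne
  -- A chord at `k`, at `z` or between two vertices of `p` would each give a shorter walk.
  have hkchord : ∀ x ∈ p.support, G.Adj k x → x = a := by
    intro x hx hkx
    by_contra hxa
    have h1 := hmin x b (p.dropUntil x hx) (hpX x hx) hkx hbz
    have h2 := SimpleGraph.Walk.length_dropUntil_lt_length hx hxa
    omega
  have hzchord : ∀ x ∈ p.support, G.Adj x z → x = b := by
    intro x hx hxz
    by_contra hxb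
    have h1 := hmin a x (p.takeUntil x hx) ha hka hxz
    have h2 := SimpleGraph.Walk.length_takeUntil_lt_length hx hxb
    omega
  have hpchord : ∀ i j, i ≤ j → j ≤ p.length → G.Adj (p.getVert i) (p.getVert j) →
      s(p.getVert i, p.getVert j) ∈ p.edges := by
    intro i j hij hj hadj
    have hadj' : (restrict G X).Adj (p.getVert i) (p.getVert j) :=
      ⟨hadj, hpX _ (p.getVert_mem_support i), hpX _ (p.getVert_mem_support j)⟩
    have h1 := hmin a b ((p.take i).append (SimpleGraph.Walk.cons hadj' (p.drop j))) ha hka hbz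
    rw [SimpleGraph.Walk.length_append, SimpleGraph.Walk.length_cons,
      SimpleGraph.Walk.take_length, SimpleGraph.Walk.drop_length] at h1
    have hij' : i ≠ j := fun h => hadj.ne (by rw [h])
    have hji : j = i + 1 := by omega
    subst hji
    exact (SimpleGraph.Walk.mk_mem_edges_iff_exists p).mpr ⟨i, by omega, rfl⟩
  rcases hcsupp x hx with rfl | rfl | hx' <;> rcases hcsupp y hy with rfl | rfl | hy'
  · exact hxy.ne rfl
  · exact hne1 rfl
  · exact hne4 (by rw [hzchord y hy' hxy.symm, Sym2.eq_swap])
  · exact hne1 Sym2.eq_swap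
  · exact hxy.ne rfl
  · exact hne2 (by rw [hkchord y hy' hxy])
  · exact hne4 (by rw [hzchord x hx' hxy])
  · exact hne2 (by rw [hkchord x hx' hxy.symm, Sym2.eq_swap])
  · obtain ⟨i, rfl, hi⟩ := SimpleGraph.Walk.mem_support_iff_exists_getVert.mp hx'
    obtain ⟨j, rfl, hj⟩ := SimpleGraph.Walk.mem_support_iff_exists_getVert.mp hy'
    rcases le_total i j with hij | hij
    · exact hne3 (hpchord i j hij hj hxy)
    · exact hne3 (by rw [Sym2.eq_swap]; exact hpchord j i hij hi hxy.symm)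

/-- Some vertex of the component of `w` is adjacent to everything attached to the component. -/
theorem IsTriangulated.exists_adj_attachment [Finite A] (hG : IsTriangulated G) {C : Set A}
    (hC : IsConvex G C) {w : A} (hw : w ∉ C) :
    ∃ w', (restrict G Cᶜ).Reachable w w' ∧ ∀ x ∈ attachment G C w, G.Adj x w' := by
  classical
  -- Choose `w'` adjacent to as many attached vertices as possible. If it misses `z`, follow a
  -- shortest path to a neighbour `b` of `z`: each attached neighbour `k` of `w'` has a common
  -- neighbour with `z` on that path, which can only be `b`. So `b` beats `w'`.
  obtain ⟨w', hw', hmax⟩ := Set.exists_max_image {w' | (restrict G Cᶜ).Reachable w w'}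
    (fun w' => {x | x ∈ attachment G C w ∧ G.Adj x w'}.ncard) (Set.toFinite _)
    ⟨w, SimpleGraph.Reachable.refl _⟩
  refine ⟨w', hw', ?_⟩
  by_contra! hcon
  obtain ⟨z, hz, hzw⟩ := hcon
  have hw'C : w' ∈ Cᶜ := mem_of_reachable_restrict hw' hw
  have hex : ∃ n, ∃ b, ∃ p : (restrict G Cᶜ).Walk w' b, G.Adj z b ∧ p.length = n := by
    obtain ⟨b, hb, hzb⟩ := hz.2
    obtain ⟨p⟩ := hw'.symm.trans hb
    exact ⟨_, b, p, hzb, rfl⟩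
  obtain ⟨b, p, hzb, hp⟩ := Nat.find_spec hex
  have hmin : ∀ (b' : A) (p' : (restrict G Cᶜ).Walk w' b'), G.Adj z b' →
      p.length ≤ p'.length := fun b' p' h => by
    rw [hp]; exact Nat.find_min' hex ⟨b', p', h, rfl⟩
  have hpC := mem_of_mem_support_restrict p hw'C
  have hsub : ∀ k ∈ attachment G C w, G.Adj k w' → G.Adj k b := by
    intro k hk hkw
    have hne : k ≠ z := fun h => hzw (h ▸ hkw)
    have hkz := hC.isClique_attachment hw hk hz hne
    obtain ⟨u, hu, hku, huz⟩ := hG.exists_common_neighbor (X := {x | x ∈ p.support}) hkz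
      (fun h => hpC k h hk.1) (fun h => hpC z h hz.1) p.start_mem_support hkw hzb.symm
      (reachable_restrict_of_walk (restrict_le _) p fun x hx => hx)
    have hub : u = b := by
      by_contra hub
      have h1 := hmin u (p.takeUntil u hu) huz.symm
      have h2 := SimpleGraph.Walk.length_takeUntil_lt_length hu hub
      omega
    exact hub ▸ hku
  have hlt : {x | x ∈ attachment G C w ∧ G.Adj x w'}.ncard <
      {x | x ∈ attachment G C w ∧ G.Adj x b}.ncard := by
    refine Set.ncard_lt_ncard ⟨fun x hx => ⟨hx.1, hsub x hx.1 hx.2⟩, fun h => ?_⟩ (Set.toFinite _)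
    exact hzw (h ⟨hz, hzb⟩).2
  exact absurd (hmax b (hw'.trans p.reachable)) (not_le.mpr hlt)

end Triangulated

/-! ### Paths in trees -/

section Trees

variable {V : Type*} {T : SimpleGraph V}

/-- Shortcutting `w` yields a path, and paths in a tree are unique. -/
theorem support_subset_of_isPath (hT : T.IsTree) {u v : V} {p : T.Walk u v} (hp : p.IsPath)
    (w : T.Walk u v) : p.support ⊆ w.support := by
  classical
  have h : p = w.bypass :=
    congrArg Subtype.val
      ((hT.isAcyclic.subsingleton_path u v).elim ⟨p, hp⟩ ⟨w.bypass, w.bypass_isPath⟩)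
  rw [h]
  exact w.support_bypass_subset_support

theorem edges_subset_of_isPath (hT : T.IsTree) {u v : V} {p : T.Walk u v} (hp : p.IsPath)
    (w : T.Walk u v) : p.edges ⊆ w.edges := by
  classical
  have h : p = w.bypass :=
    congrArg Subtype.val
      ((hT.isAcyclic.subsingleton_path u v).elim ⟨p, hp⟩ ⟨w.bypass, w.bypass_isPath⟩)
  rw [h]
  exact w.edges_bypass_subset_edges

/-- In a tree, deleting an edge of a path separates the ends of the path. -/
theorem not_reachable_deleteEdges (hT : T.IsTree) {u v : V} {p : T.Walk u v} (hp : p.IsPath)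
    {e : Sym2 V} (he : e ∈ p.edges) : ¬ (T.deleteEdges {e}).Reachable u v := by
  rintro ⟨w⟩
  have h := edges_subset_of_isPath hT hp (w.mapLe (T.deleteEdges_le {e})) he
  rw [SimpleGraph.Walk.edges_mapLe_eq_edges] at h
  have := w.edges_subset_edgeSet h
  simp at this

end Trees

/-! ### Existence of junction trees -/

section JunctionTrees

variable {A : Type*} {G : SimpleGraph A}

/-- The edges of `T` whose separator contains `x`. -/
def itemGraph (T : SimpleGraph (MaxClique G)) (x : A) : SimpleGraph (MaxClique G) where
  Adj P R := T.Adj P R ∧ x ∈ P.1 ∧ x ∈ R.1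
  symm := ⟨fun _ _ h => ⟨h.1.symm, h.2.2, h.2.1⟩⟩
  loopless := ⟨fun _ h => T.loopless.irrefl _ h.1⟩

theorem itemGraph_le (T : SimpleGraph (MaxClique G)) (x : A) : itemGraph T x ≤ T :=
  fun _ _ h => h.1

theorem mem_of_mem_support_itemGraph {T : SimpleGraph (MaxClique G)} {x : A} {P R : MaxClique G}
    (p : (itemGraph T x).Walk P R) (hP : x ∈ P.1) : ∀ S ∈ p.support, x ∈ S.1 := by
  induction p with
  | nil => simpa using hP
  | cons h p ih =>
    intro S hS
    rw [SimpleGraph.Walk.support_cons, List.mem_cons] at hS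
    rcases hS with rfl | hS
    · exact hP
    · exact ih h.2.2 S hS

theorem exists_maxClique_superset [Finite A] {s : Set A} (hs : G.IsClique s) :
    ∃ M : MaxClique G, s ⊆ M.1 := by
  have hfin : s.Finite := Set.toFinite s
  obtain ⟨Q, hsQ, hQ⟩ := Finite.exists_le_maximal
    (p := fun s : Finset A => G.IsClique (s : Set A)) (a := hfin.toFinset) (by simpa using hs)
  exact ⟨⟨Q, hQ⟩, fun x hx => hsQ (by simpa using hx)⟩

theorem MaxClique.isClique (M : MaxClique G) : G.IsClique (M.1 : Set A) := M.2.1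

theorem MaxClique.eq_of_subset {M N : MaxClique G} (h : M.1 ⊆ N.1) : M = N :=
  Subtype.ext (h.antisymm (M.2.2 N.2.1 h))

theorem itemGraph_mono {T T' : SimpleGraph (MaxClique G)} (h : T ≤ T') (x : A) :
    itemGraph T x ≤ itemGraph T' x := fun _ _ hadj => ⟨h hadj.1, hadj.2⟩

theorem itemGraph_reachable_of_walk {T : SimpleGraph (MaxClique G)} {x : A} {P R : MaxClique G}
    (p : T.Walk P R) (h : ∀ S ∈ p.support, x ∈ S.1) : (itemGraph T x).Reachable P R := by
  induction p with
  | nil => exact SimpleGraph.Reachable.refl _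
  | cons hadj p ih =>
    have hp : ∀ S ∈ p.support, x ∈ S.1 := fun S hS => h S (by simp [hS])
    have hadj' : (itemGraph T x).Adj _ _ := ⟨hadj, h _ (by simp), hp _ p.start_mem_support⟩
    exact hadj'.reachable.trans (ih hp)

variable [DecidableEq A]

/-- A connected subgraph of the clique graph with few edges in which the cliques of each item are
connected is a junction tree. -/
theorem IsJunctionTree.of_reachable [Finite A] {T : SimpleGraph (MaxClique G)}
    (hle : T ≤ cliqueGraph G) (hconn : T.Connected)
    (hcard : T.edgeSet.ncard + 1 ≤ Nat.card (MaxClique G))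
    (hitem : ∀ x (P R : MaxClique G), x ∈ P.1 → x ∈ R.1 → (itemGraph T x).Reachable P R) :
    IsJunctionTree G T := by
  -- Connectedness gives the opposite bound on the number of edges, so acyclicity need not be
  -- tracked.
  have htree : T.IsTree := by
    refine SimpleGraph.isTree_iff_connected_and_card.mpr ⟨hconn, le_antisymm ?_ ?_⟩
    · exact hcard
    · exact hconn.card_vert_le_card_edgeSet_add_one
  refine ⟨hle, htree, fun Q R w hw x hxQ hxR S hS => ?_⟩
  obtain ⟨p⟩ := hitem x Q R hxQ hxR
  have h := support_subset_of_isPath htree hw (p.mapLe (itemGraph_le T x)) hS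
  rw [SimpleGraph.Walk.support_mapLe_eq_support] at h
  exact mem_of_mem_support_itemGraph p hxQ S h

theorem IsJunctionTree.itemGraph_reachable {T : SimpleGraph (MaxClique G)}
    (hT : IsJunctionTree G T) {x : A} {P R : MaxClique G} (hP : x ∈ P.1) (hR : x ∈ R.1) :
    (itemGraph T x).Reachable P R := by
  obtain ⟨p, hp⟩ := hT.isTree.connected.exists_isPath P R
  exact itemGraph_reachable_of_walk p (hT.running_intersection P R p hp x hP hR)

/-- A junction tree for the set `𝒮` of cliques, whose union is convex and contains no cliques but
those inside members of `𝒮`. -/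
structure IsPartialJunctionTree (𝒮 : Set (MaxClique G)) (T : SimpleGraph (MaxClique G)) :
    Prop where
  mem_of_adj : ∀ P R, T.Adj P R → P ∈ 𝒮
  le_cliqueGraph : T ≤ cliqueGraph G
  reachable : ∀ P ∈ 𝒮, ∀ R ∈ 𝒮, T.Reachable P R
  card_le : T.edgeSet.ncard + 1 ≤ 𝒮.ncard
  item_reachable : ∀ x, ∀ P ∈ 𝒮, ∀ R ∈ 𝒮, x ∈ P.1 → x ∈ R.1 → (itemGraph T x).Reachable P R
  isConvex : IsConvex G {x | ∃ P ∈ 𝒮, x ∈ P.1}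
  exists_superset : ∀ s : Set A, G.IsClique s → s ⊆ {x | ∃ P ∈ 𝒮, x ∈ P.1} →
    ∃ P ∈ 𝒮, s ⊆ (P.1 : Set A)

/-- A partial junction tree not covering all items can be extended by one clique. -/
theorem IsPartialJunctionTree.exists_insert [Finite A] (hconn : G.Connected)
    (htri : IsTriangulated G) {𝒮 : Set (MaxClique G)} {T : SimpleGraph (MaxClique G)}
    (h : IsPartialJunctionTree 𝒮 T) {w : A} (hw : ¬ ∃ P ∈ 𝒮, w ∈ P.1) :
    ∃ M ∉ 𝒮, ∃ T', IsPartialJunctionTree (insert M 𝒮) T' := by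
  classical
  set U : Set A := {x | ∃ P ∈ 𝒮, x ∈ P.1} with hU
  have hwU : w ∉ U := hw
  obtain ⟨w', hww', hadj⟩ := htri.exists_adj_attachment h.isConvex hwU
  have hw'U : w' ∉ U := mem_of_reachable_restrict hww' hwU
  set K := attachment G U w with hK
  have hKclique : G.IsClique K := h.isConvex.isClique_attachment hwU
  have hKU : K ⊆ U := fun x hx => hx.1
  obtain ⟨M, hM⟩ := exists_maxClique_superset
    (hKclique.insert (a := w') fun b hb _ => (hadj b hb).symm)
  have hw'M : w' ∈ M.1 := hM (Set.mem_insert _ _)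
  have hKM : K ⊆ M.1 := fun x hx => hM (Set.mem_insert_of_mem _ hx)
  have hMsub : ∀ y ∈ (M.1 : Set A), y ∈ K ∨ (restrict G Uᶜ).Reachable w y :=
    clique_subset_attachment_union hwU hww' M.isClique hw'M
  have hM𝒮 : M ∉ 𝒮 := fun hmem => hw'U ⟨M, hmem, hw'M⟩
  have hMU : ∀ x ∈ M.1, x ∈ U → x ∈ K := fun x hx hxU =>
    (hMsub x hx).resolve_right fun hr => mem_of_reachable_restrict hr hwU hxU
  -- The new clique `M` meets the old union exactly in `K`. Hanging it on a clique `P` containing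
  -- `K` keeps the cliques of each item connected.
  obtain ⟨P, hP, hKP⟩ := h.exists_superset K hKclique hKU
  have hPM : P ≠ M := fun heq => hM𝒮 (heq ▸ hP)
  have hKne : K.Nonempty := by
    refine attachment_nonempty hconn ?_ hwU
    -- If the union were empty, `P` would be empty and hence, by maximality, equal to `M`.
    by_contra hUe
    rw [Set.not_nonempty_iff_eq_empty] at hUe
    refine hPM (MaxClique.eq_of_subset fun x hx => ?_)
    have hxU : x ∈ U := ⟨P, hP, hx⟩
    simp [hUe] at hxU
  have hunion : {x | ∃ R ∈ insert M 𝒮, x ∈ R.1} = U ∪ (M.1 : Set A) := by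
    ext x
    simp [hU, or_comm]
  set T' := T ⊔ SimpleGraph.edge P M with hT'
  have hTT' : T ≤ T' := le_sup_left
  have hPMadj : T'.Adj P M := Or.inr ((SimpleGraph.edge_adj ..).mpr ⟨Or.inl ⟨rfl, rfl⟩, hPM⟩)
  have hadj' : ∀ {Q R}, T'.Adj Q R → T.Adj Q R ∨ (Q = P ∧ R = M) ∨ (Q = M ∧ R = P) := by
    intro Q R hQR
    rcases hQR with hQR | hQR
    · exact Or.inl hQR
    · exact Or.inr ((SimpleGraph.edge_adj ..).mp hQR).1
  refine ⟨M, hM𝒮, T', ?_, ?_, ?_, ?_, ?_, ?_, ?_⟩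
  · intro Q R hQR
    rcases hadj' hQR with hQR | ⟨rfl, rfl⟩ | ⟨rfl, rfl⟩
    · exact Set.mem_insert_of_mem _ (h.mem_of_adj Q R hQR)
    · exact Set.mem_insert_of_mem _ hP
    · exact Set.mem_insert _ _
  · obtain ⟨k, hk⟩ := hKne
    have hPM' : (cliqueGraph G).Adj P M :=
      ⟨hPM, k, Finset.mem_inter.mpr ⟨hKP hk, hKM hk⟩⟩
    intro Q R hQR
    rcases hadj' hQR with hQR | ⟨rfl, rfl⟩ | ⟨rfl, rfl⟩
    · exact h.le_cliqueGraph hQR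
    · exact hPM'
    · exact hPM'.symm
  · have hreach : ∀ Q ∈ insert M 𝒮, T'.Reachable Q P := by
      rintro Q (rfl | hQ)
      · exact hPMadj.symm.reachable
      · exact (h.reachable Q hQ P hP).mono hTT'
    intro Q hQ R hR
    exact (hreach Q hQ).trans (hreach R hR).symm
  · rw [Set.ncard_insert_of_notMem hM𝒮 (Set.toFinite _)]
    have h1 : T'.edgeSet.ncard ≤ T.edgeSet.ncard + 1 := by
      rw [hT', SimpleGraph.edgeSet_sup, SimpleGraph.edgeSet_edge_of_ne hPM]
      exact (Set.ncard_union_le _ _).trans (by simp)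
    have h2 := h.card_le
    omega
  · have hMR : ∀ x, ∀ R ∈ 𝒮, x ∈ M.1 → x ∈ R.1 → (itemGraph T' x).Reachable M R := by
      intro x R hR hxM hxR
      have hxP : x ∈ P.1 := hKP (hMU x hxM ⟨R, hR, hxR⟩)
      have hMP : (itemGraph T' x).Adj M P := ⟨hPMadj.symm, hxM, hxP⟩
      exact hMP.reachable.trans
        ((h.item_reachable x P hP R hR hxP hxR).mono (itemGraph_mono hTT' x))
    rintro x Q (rfl | hQ) R (rfl | hR) hxQ hxR
    · exact SimpleGraph.Reachable.refl _
    · exact hMR x R hR hxQ hxR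
    · exact (hMR x Q hQ hxR hxQ).symm
    · exact (h.item_reachable x Q hQ R hR hxQ hxR).mono (itemGraph_mono hTT' x)
  · rw [hunion]
    exact h.isConvex.union_clique hwU M.isClique hKM hMsub
  · intro s hs hsub
    rw [hunion] at hsub
    rcases clique_subset_or_subset_of_union hwU hKM hMsub hs hsub with hsU | hsM
    · obtain ⟨R, hR, hsR⟩ := h.exists_superset s hs hsU
      exact ⟨R, Set.mem_insert_of_mem _ hR, hsR⟩
    · exact ⟨M, Set.mem_insert _ _, hsM⟩

/-- A connected triangulated graph has a junction tree. -/
theorem exists_isJunctionTree [Finite A] (hconn : G.Connected) (htri : IsTriangulated G) :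
    ∃ T : SimpleGraph (MaxClique G), IsJunctionTree G T := by
  classical
  obtain ⟨M₀, -⟩ := exists_maxClique_superset (G := G) (s := ∅) (by simp)
  have hstart : IsPartialJunctionTree ({M₀} : Set (MaxClique G)) ⊥ := by
    refine ⟨by simp, bot_le, ?_, by simp, ?_, ?_, ?_⟩
    · rintro P rfl R rfl; exact SimpleGraph.Reachable.refl _
    · rintro x P rfl R rfl _ _; exact SimpleGraph.Reachable.refl _
    · intro x y u v hx hy _ _ _ _ _ hne
      simp only [Set.mem_singleton_iff, exists_eq_left, Set.mem_ofPred_eq] at hx hy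
      exact M₀.isClique hx hy hne
    · intro s _ hsub
      exact ⟨M₀, rfl, by simpa using hsub⟩
  obtain ⟨𝒮, ⟨T, hT⟩, hmax⟩ := Set.exists_max_image
    {𝒮 : Set (MaxClique G) | ∃ T, IsPartialJunctionTree 𝒮 T} Set.ncard (Set.toFinite _)
    ⟨_, _, hstart⟩
  have hcover : ∀ w : A, ∃ P ∈ 𝒮, w ∈ P.1 := by
    by_contra! hw
    obtain ⟨w, hw⟩ := hw
    obtain ⟨M, hM, T', hT'⟩ := hT.exists_insert hconn htri (w := w)
      (by rintro ⟨P, hP, hwP⟩; exact hw P hP hwP)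
    have := hmax _ ⟨T', hT'⟩
    rw [Set.ncard_insert_of_notMem hM (Set.toFinite _)] at this
    omega
  have huniv : ∀ M : MaxClique G, M ∈ 𝒮 := by
    intro M
    obtain ⟨P, hP, hMP⟩ := hT.exists_superset M.1 M.isClique fun x _ => hcover x
    exact (MaxClique.eq_of_subset (Finset.coe_subset.mp hMP)) ▸ hP
  have h𝒮 : 𝒮 = Set.univ := Set.eq_univ_of_forall huniv
  refine ⟨T, IsJunctionTree.of_reachable hT.le_cliqueGraph ?_ ?_ fun x P R hP hR =>
    hT.item_reachable x P (huniv P) R (huniv R) hP hR⟩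
  · have : Nonempty (MaxClique G) := ⟨M₀⟩
    exact ⟨fun P R => hT.reachable P (huniv P) R (huniv R)⟩
  · have := hT.card_le
    rwa [h𝒮, Set.ncard_univ] at this

end JunctionTrees

/-! ### Separator items form a convex set -/

section Separators

variable {A : Type*} {G : SimpleGraph A}

theorem exists_maxClique_of_adj [Finite A] {x y : A} (h : G.Adj x y) :
    ∃ M : MaxClique G, x ∈ M.1 ∧ y ∈ M.1 := by
  obtain ⟨M, hM⟩ := exists_maxClique_superset (G := G) (s := {x, y})
    (by rw [SimpleGraph.isClique_pair]; exact fun _ => h)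
  exact ⟨M, hM (by simp), hM (by simp)⟩

/-- If every separator on a walk contains `x` or `y`, and `x` is in the first clique but never
together with `y` in a clique, then `x` is in the last clique. -/
theorem mem_of_forall_separator {T : SimpleGraph (MaxClique G)} {x y : A}
    (hxy : ∀ P : MaxClique G, x ∈ P.1 → y ∉ P.1) {P R : MaxClique G} (p : T.Walk P R)
    (hP : x ∈ P.1) (h : ∀ e ∈ p.edges, (∀ S ∈ e, x ∈ S.1) ∨ (∀ S ∈ e, y ∈ S.1)) : x ∈ R.1 := by
  induction p with
  | nil => exact hP
  | cons hadj p ih =>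
    refine ih ?_ fun e he => h e (by simp [he])
    rcases h _ (List.mem_cons_self) with h' | h'
    · exact h' _ (Sym2.mem_mk_right _ _)
    · exact absurd (h' _ (Sym2.mem_mk_left _ _)) (hxy _ hP)

variable [DecidableEq A]

/-- The cliques containing `x` are joined by edges whose separators contain `x`, and `e` is not one
of these. -/
theorem IsJunctionTree.deleteEdges_reachable {T : SimpleGraph (MaxClique G)}
    (hT : IsJunctionTree G T) {e : Sym2 (MaxClique G)} {x : A} (hx : ¬ ∀ S ∈ e, x ∈ S.1)
    {P R : MaxClique G} (hP : x ∈ P.1) (hR : x ∈ R.1) : (T.deleteEdges {e}).Reachable P R := by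
  refine (hT.itemGraph_reachable hP hR).mono fun U V hUV => ?_
  rw [SimpleGraph.deleteEdges_adj]
  refine ⟨hUV.1, fun he => hx fun S hS => ?_⟩
  rw [Set.mem_singleton_iff] at he
  rw [← he, Sym2.mem_iff] at hS
  rcases hS with rfl | rfl
  · exact hUV.2.1
  · exact hUV.2.2

/-- The separator of an edge of a junction tree separates the items on its two sides. -/
theorem IsJunctionTree.deleteEdges_reachable_of_walk [Finite A] {T : SimpleGraph (MaxClique G)}
    (hT : IsJunctionTree G T) {e : Sym2 (MaxClique G)} {x y : A} (p : G.Walk x y)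
    (hp : ∀ z ∈ p.support, ¬ ∀ S ∈ e, z ∈ S.1) {P R : MaxClique G} (hP : x ∈ P.1)
    (hR : y ∈ R.1) : (T.deleteEdges {e}).Reachable P R := by
  induction p generalizing P with
  | nil => exact hT.deleteEdges_reachable (hp _ (by simp)) hP hR
  | cons hadj p ih =>
    obtain ⟨M, hxM, hcM⟩ := exists_maxClique_of_adj hadj
    exact (hT.deleteEdges_reachable (hp _ (by simp)) hP hxM).trans
      (ih (fun z hz => hp z (by simp [hz])) hcM hR)

/-- For a separator item the walk is a piece of the path containing that separator; for an item of
`B` it is trivial. -/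
theorem exists_walk_of_mem_union_separatorItems {T : SimpleGraph (MaxClique G)} {B : Finset A}
    {Q : B → MaxClique G} (hQ : IsCliqueChoice B Q) {x : A}
    (hx : x ∈ (B : Set A) ∪ separatorItems (pathSeparators T Q)) :
    ∃ (P : MaxClique G) (b : B) (p : T.Walk P (Q b)), x ∈ P.1 ∧
      ∀ e ∈ p.edges, e ∈ pathSeparators T Q := by
  classical
  rcases hx with hx | ⟨e, ⟨b, c, w, hw, hew⟩, hxe⟩
  · exact ⟨Q ⟨x, hx⟩, ⟨x, hx⟩, SimpleGraph.Walk.nil, hQ ⟨x, hx⟩, by simp⟩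
  · induction e with
    | _ U V =>
      have hU : U ∈ w.support := w.fst_mem_support_of_mem_edges hew
      refine ⟨U, b, (w.takeUntil U hU).reverse, hxe U (Sym2.mem_mk_left _ _), fun e he => ?_⟩
      rw [SimpleGraph.Walk.edges_reverse, List.mem_reverse] at he
      exact ⟨b, c, w, hw, w.edges_takeUntil_subset_edges hU he⟩

/-- `B` together with the items of the separators between the chosen cliques is convex. -/
theorem IsJunctionTree.isConvex_union_separatorItems [Finite A] {T : SimpleGraph (MaxClique G)}
    (hT : IsJunctionTree G T) {B : Finset A} {Q : B → MaxClique G} (hQ : IsCliqueChoice B Q) :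
    IsConvex G ((B : Set A) ∪ separatorItems (pathSeparators T Q)) := by
  classical
  intro x y u v hx hy hu hv hxu hyv huv hne
  by_contra hxy
  have hno : ∀ P : MaxClique G, x ∈ P.1 → y ∉ P.1 := fun P hxP hyP =>
    hxy (P.isClique hxP hyP hne)
  obtain ⟨P, b, p, hxP, hp⟩ := exists_walk_of_mem_union_separatorItems hQ hx
  obtain ⟨R, c, r, hyR, hr⟩ := exists_walk_of_mem_union_separatorItems hQ hy
  obtain ⟨w, hw⟩ := hT.isTree.connected.exists_isPath (Q b) (Q c)
  set q := (p.append (w.append r.reverse)).bypass with hq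
  have hqE : ∀ e ∈ q.edges, e ∈ pathSeparators T Q := by
    intro e he
    have he' := SimpleGraph.Walk.edges_bypass_subset_edges _ he
    rw [SimpleGraph.Walk.edges_append, SimpleGraph.Walk.edges_append,
      SimpleGraph.Walk.edges_reverse, List.mem_append, List.mem_append, List.mem_reverse] at he'
    rcases he' with h | h | h
    · exact hp e h
    · exact ⟨b, c, w, hw, h⟩
    · exact hr e h
  -- Otherwise `x`, never sharing a clique with `y`, would be carried along `q` into `R`, which
  -- contains `y`. Deleting `e` separates `P` from `R`, yet the walk from `x` through `u` and `v` to
  -- `y` avoids the separator of `e`.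
  obtain ⟨e, he, hxe, hye⟩ : ∃ e ∈ q.edges, (¬ ∀ S ∈ e, x ∈ S.1) ∧ ¬ ∀ S ∈ e, y ∈ S.1 := by
    by_contra hcon
    refine hno R (mem_of_forall_separator hno q hxP fun e he => ?_) hyR
    by_contra hor
    rw [not_or] at hor
    exact hcon ⟨e, he, hor⟩
  obtain ⟨g⟩ := huv
  have hg := mem_of_mem_support_restrict g hu
  refine not_reachable_deleteEdges hT.isTree (SimpleGraph.Walk.bypass_isPath _) he
    (hT.deleteEdges_reachable_of_walk
      (SimpleGraph.Walk.cons hxu ((g.mapLe (restrict_le _)).concat hyv.symm)) ?_ hxP hyR)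
  intro z hz
  rw [SimpleGraph.Walk.support_cons, SimpleGraph.Walk.support_concat,
    SimpleGraph.Walk.support_mapLe_eq_support] at hz
  simp only [List.mem_cons, List.mem_append, List.not_mem_nil,
    or_false] at hz
  rcases hz with rfl | hz | rfl
  · exact hxe
  · exact fun h => hg z hz (Or.inr ⟨e, hqE e he, h⟩)
  · exact hye

end Separators

/-! ### Rehanging a junction tree at one clique -/

section Exchange

variable {V : Type*}

open Classical in
/-- The map collapsing `X` to the vertex `L`. -/
noncomputable def collapse (X : Set V) (L : V) (P : V) : V := if P ∈ X then L else P

theorem collapse_of_mem {X : Set V} {L P : V} (h : P ∈ X) : collapse X L P = L := if_pos h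

theorem collapse_of_notMem {X : Set V} {L P : V} (h : P ∉ X) : collapse X L P = P := if_neg h

/-- The graph obtained from `T` by attaching to `L` all edges that leave `X`. -/
def reattach (T : SimpleGraph V) (X : Set V) (L : V) : SimpleGraph V where
  Adj P R := (T.Adj P R ∧ P ∈ X ∧ R ∈ X) ∨
    (P ≠ R ∧ ∃ U V, T.Adj U V ∧ ¬ (U ∈ X ∧ V ∈ X) ∧ collapse X L U = P ∧ collapse X L V = R)
  symm := ⟨by
    rintro P R (⟨h, hP, hR⟩ | ⟨hne, U, V, h, hX, hU, hV⟩)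
    · exact Or.inl ⟨h.symm, hR, hP⟩
    · exact Or.inr ⟨hne.symm, V, U, h.symm, fun h' => hX h'.symm, hV, hU⟩⟩
  loopless := ⟨by
    rintro P (⟨h, _⟩ | ⟨h, _⟩)
    · exact T.loopless.irrefl _ h
    · exact h rfl⟩

theorem collapse_ne {T : SimpleGraph V} {X : Set V} {L : V} (hL : L ∈ X) {P R : V}
    (h : T.Adj P R) (hX : ¬ (P ∈ X ∧ R ∈ X)) : collapse X L P ≠ collapse X L R := by
  by_cases hP : P ∈ X <;> by_cases hR : R ∈ X
  · exact absurd ⟨hP, hR⟩ hX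
  · rw [collapse_of_mem hP, collapse_of_notMem hR]
    exact fun h => hR (h ▸ hL)
  · rw [collapse_of_mem hR, collapse_of_notMem hP]
    exact fun h => hP (h ▸ hL)
  · rw [collapse_of_notMem hP, collapse_of_notMem hR]
    exact h.ne

theorem reattach_adj_collapse {T : SimpleGraph V} {X : Set V} {L : V} (hL : L ∈ X) {P R : V}
    (h : T.Adj P R) (hX : ¬ (P ∈ X ∧ R ∈ X)) :
    (reattach T X L).Adj (collapse X L P) (collapse X L R) :=
  Or.inr ⟨collapse_ne hL h hX, P, R, h, hX, rfl, rfl⟩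

/-- Every new edge is the image of an old one: edges inside `X` are kept, all others are collapsed.
-/
theorem ncard_edgeSet_reattach_le [Finite V] (T : SimpleGraph V) (X : Set V) (L : V) :
    (reattach T X L).edgeSet.ncard ≤ T.edgeSet.ncard := by
  classical
  have hsub : (reattach T X L).edgeSet ⊆
      (fun e : Sym2 V => if ∀ P ∈ e, P ∈ X then e else e.map (collapse X L)) '' T.edgeSet := by
    intro e he
    induction e with
    | _ P R =>
      rw [SimpleGraph.mem_edgeSet] at he
      rcases he with ⟨h, hP, hR⟩ | ⟨-, U, V, h, hX, rfl, rfl⟩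
      · exact ⟨s(P, R), h, by simp [hP, hR]⟩
      · refine ⟨s(U, V), h, ?_⟩
        simp only [Sym2.mem_iff, forall_eq_or_imp, forall_eq, if_neg hX, Sym2.map_mk]
  exact (Set.ncard_le_ncard hsub (Set.toFinite _)).trans (Set.ncard_image_le (Set.toFinite _))

/-- Walks collapse along with `X`, losing the edges inside `X`. -/
theorem exists_walk_reattach {T : SimpleGraph V} {X : Set V} {L : V} (hL : L ∈ X) {P R : V}
    (p : T.Walk P R) : ∃ p' : (reattach T X L).Walk (collapse X L P) (collapse X L R),
      ∀ f ∈ p'.edges, ∃ e ∈ p.edges, (¬ ∀ S ∈ e, S ∈ X) ∧ e.map (collapse X L) = f := by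
  induction p with
  | nil => exact ⟨SimpleGraph.Walk.nil, by simp⟩
  | @cons P M R h p ih =>
    obtain ⟨p', hp'⟩ := ih
    by_cases hX : P ∈ X ∧ M ∈ X
    · have heq : collapse X L P = collapse X L M := by
        rw [collapse_of_mem hX.1, collapse_of_mem hX.2]
      rw [heq]
      refine ⟨p', fun f hf => ?_⟩
      obtain ⟨e, he, h'⟩ := hp' f hf
      exact ⟨e, by simp [he], h'⟩
    · refine ⟨SimpleGraph.Walk.cons (reattach_adj_collapse hL h hX) p', fun f hf => ?_⟩
      rw [SimpleGraph.Walk.edges_cons, List.mem_cons] at hf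
      rcases hf with rfl | hf
      · exact ⟨s(P, M), by simp, by simpa using hX, by simp⟩
      · obtain ⟨e, he, h'⟩ := hp' f hf
        exact ⟨e, by simp [he], h'⟩

variable {A : Type*} [DecidableEq A] {G : SimpleGraph A}

/-- In a junction tree, the cliques meeting a connected set `Y` of items are connected. -/
theorem IsJunctionTree.restrict_reachable [Finite A] {T : SimpleGraph (MaxClique G)}
    (hT : IsJunctionTree G T) {Y : Set A} {H : SimpleGraph A} (hH : H ≤ G) {u v : A}
    (p : H.Walk u v) (hp : ∀ z ∈ p.support, z ∈ Y) {P R : MaxClique G}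
    (hP : u ∈ P.1) (hR : v ∈ R.1) :
    (restrict T {S : MaxClique G | ∃ z ∈ S.1, z ∈ Y}).Reachable P R := by
  have key : ∀ z ∈ Y, itemGraph T z ≤ restrict T {S : MaxClique G | ∃ z ∈ S.1, z ∈ Y} :=
    fun z hz U V h => ⟨h.1, ⟨z, h.2.1, hz⟩, ⟨z, h.2.2, hz⟩⟩
  induction p generalizing P with
  | nil => exact (hT.itemGraph_reachable hP hR).mono (key _ (hp _ (by simp)))
  | cons hadj p ih =>
    obtain ⟨M, hxM, hcM⟩ := exists_maxClique_of_adj (hH hadj)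
    exact ((hT.itemGraph_reachable hP hxM).mono (key _ (hp _ (by simp)))).trans
      (ih (fun z hz => hp z (by simp [hz])) hcM hR)

/-- If `X` is connected in the junction tree `T` and `L ∈ X` contains all separators on the edges
leaving `X`, then these edges can be attached to `L`. -/
theorem IsJunctionTree.reattach [Finite A] {T : SimpleGraph (MaxClique G)}
    (hT : IsJunctionTree G T) {X : Set (MaxClique G)} {L : MaxClique G} (hL : L ∈ X)
    (hX : ∀ P ∈ X, (restrict T X).Reachable P L)
    (hsep : ∀ P ∈ X, ∀ R ∉ X, T.Adj P R → ∀ x ∈ P.1, x ∈ R.1 → x ∈ L.1) :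
    IsJunctionTree G (reattach T X L) := by
  -- A removed edge from `P` to `R` is replaced by the path from `P` to `L`, which stays in `X` and
  -- in the cliques of `x`, followed by the new edge from `L` to `R`.
  have hcross : ∀ {x P R}, T.Adj P R → P ∈ X → R ∉ X → x ∈ P.1 → x ∈ R.1 →
      (itemGraph (SafeProjection.reattach T X L) x).Reachable P R := by
    intro x P R h hP hR hxP hxR
    have hxL := hsep P hP R hR h x hxP hxR
    obtain ⟨p, hp⟩ := hT.isTree.connected.exists_isPath P L
    have hpx := hT.running_intersection P L p hp x hxP hxL
    obtain ⟨q⟩ := hX P hP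
    have hpX : ∀ S ∈ p.support, S ∈ X := by
      intro S hS
      have h' := support_subset_of_isPath hT.isTree hp (q.mapLe (restrict_le X)) hS
      rw [SimpleGraph.Walk.support_mapLe_eq_support] at h'
      exact mem_of_mem_support_restrict q hP S h'
    have hPL : (itemGraph (SafeProjection.reattach T X L) x).Reachable P L := by
      obtain ⟨r⟩ := reachable_restrict_of_walk (G := T) le_rfl (X := X ∩ {S | x ∈ S.1}) p
        fun S hS => ⟨hpX S hS, hpx S hS⟩
      refine r.reachable.mono fun U V hUV => ?_
      exact ⟨Or.inl ⟨hUV.1, hUV.2.1.1, hUV.2.2.1⟩, hUV.2.1.2, hUV.2.2.2⟩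
    have hLR := reattach_adj_collapse hL h fun h' => hR h'.2
    rw [collapse_of_mem hP, collapse_of_notMem hR] at hLR
    have hLR' : (itemGraph (SafeProjection.reattach T X L) x).Adj L R := ⟨hLR, hxL, hxR⟩
    exact hPL.trans hLR'.reachable
  have hstep : ∀ {x P R}, T.Adj P R → x ∈ P.1 → x ∈ R.1 →
      (itemGraph (SafeProjection.reattach T X L) x).Reachable P R := by
    intro x P R h hxP hxR
    by_cases hP : P ∈ X <;> by_cases hR : R ∈ X
    · have : (itemGraph (SafeProjection.reattach T X L) x).Adj P R :=
        ⟨Or.inl ⟨h, hP, hR⟩, hxP, hxR⟩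
      exact this.reachable
    · exact hcross h hP hR hxP hxR
    · exact (hcross h.symm hR hP hxR hxP).symm
    · have h' := reattach_adj_collapse hL h fun h' => hR h'.2
      rw [collapse_of_notMem hP, collapse_of_notMem hR] at h'
      have : (itemGraph (SafeProjection.reattach T X L) x).Adj P R := ⟨h', hxP, hxR⟩
      exact this.reachable
  have hmem : ∀ {x P R}, T.Adj P R → ¬ (P ∈ X ∧ R ∈ X) → x ∈ P.1 → x ∈ R.1 →
      x ∈ (collapse X L P).1 := by
    intro x P R h hPR hxP hxR
    by_cases hP : P ∈ X
    · rw [collapse_of_mem hP]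
      exact hsep P hP R (fun hR => hPR ⟨hP, hR⟩) h x hxP hxR
    · rwa [collapse_of_notMem hP]
  refine IsJunctionTree.of_reachable ?_ ?_ ?_ ?_
  · rintro P R (⟨h, -⟩ | ⟨hne, U, V, h, hUV, rfl, rfl⟩)
    · exact hT.le_cliqueGraph h
    · obtain ⟨x, hx⟩ := (hT.le_cliqueGraph h).2
      rw [Finset.mem_inter] at hx
      exact ⟨hne, x, Finset.mem_inter.mpr ⟨hmem h hUV hx.1 hx.2,
        hmem h.symm (fun h' => hUV h'.symm) hx.2 hx.1⟩⟩
  · have := hT.isTree.connected.nonempty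
    refine ⟨fun P R => ?_⟩
    obtain ⟨p⟩ := hT.isTree.connected.preconnected P R
    induction p with
    | nil => exact SimpleGraph.Reachable.refl _
    | cons h p ih =>
      obtain ⟨x, hx⟩ := (hT.le_cliqueGraph h).2
      rw [Finset.mem_inter] at hx
      exact ((hstep h hx.1 hx.2).mono (itemGraph_le _ x)).trans ih
  · rw [← (SimpleGraph.isTree_iff_connected_and_card.mp hT.isTree).2]
    exact Nat.add_le_add_right (ncard_edgeSet_reattach_le T X L) 1
  · intro x P R hP hR
    obtain ⟨p⟩ := hT.itemGraph_reachable hP hR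
    clear hP hR
    induction p with
    | nil => exact SimpleGraph.Reachable.refl _
    | cons h p ih => exact (hstep h.1 h.2.1 h.2.2).trans ih

/-- If a separator between the chosen cliques is not contained in the convex set `C ⊇ B`, then
there is a junction tree with a choice of cliques that has fewer separators. -/
theorem IsJunctionTree.exists_fewer_pathSeparators [Finite A] (htri : IsTriangulated G)
    {T : SimpleGraph (MaxClique G)} (hT : IsJunctionTree G T) {B : Finset A}
    {Q : B → MaxClique G} (hQ : IsCliqueChoice B Q) {C : Set A} (hC : IsConvex G C)
    (hBC : (B : Set A) ⊆ C) {x : A} (hx : x ∈ separatorItems (pathSeparators T Q))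
    (hxC : x ∉ C) :
    ∃ (T' : SimpleGraph (MaxClique G)) (Q' : B → MaxClique G), IsJunctionTree G T' ∧
      IsCliqueChoice B Q' ∧ (pathSeparators T' Q').ncard < (pathSeparators T Q).ncard := by
  obtain ⟨e, he, hxe⟩ := hx
  -- `X` consists of the cliques meeting the component of `x` outside `C`, and `L` is a clique of
  -- `X` containing the whole attachment. Any item of a clique in `X` that is not in the component
  -- is attached to it, hence lies in `L`.
  set X : Set (MaxClique G) := {S | ∃ z ∈ S.1, z ∈ {z | (restrict G Cᶜ).Reachable x z}}
  obtain ⟨w, hxw, hadj⟩ := htri.exists_adj_attachment hC hxC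
  obtain ⟨L, hLsub⟩ := exists_maxClique_superset
    ((hC.isClique_attachment hxC).insert (a := w) fun b hb _ => (hadj b hb).symm)
  have hwL : w ∈ L.1 := hLsub (Set.mem_insert _ _)
  have hL : L ∈ X := ⟨w, hwL, hxw⟩
  have hmemL : ∀ P ∈ X, ∀ y ∈ P.1, ¬ (restrict G Cᶜ).Reachable x y → y ∈ L.1 := by
    rintro P ⟨z, hzP, hxz⟩ y hy hxy
    exact hLsub (Set.mem_insert_of_mem _
      ((clique_subset_attachment_union hxC hxz P.isClique hzP y hy).resolve_right hxy))
  have hTree : IsJunctionTree G (SafeProjection.reattach T X L) := by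
    refine hT.reattach hL ?_ ?_
    · rintro P ⟨z, hzP, hxz⟩
      obtain ⟨p⟩ := (hxz : (restrict G Cᶜ).Reachable x z).symm.trans hxw
      classical
      exact hT.restrict_reachable (restrict_le _) p
        (fun y hy => hxz.trans (p.takeUntil y hy).reachable) hzP hwL
    · intro P hP R hR _ y hyP hyR
      exact hmemL P hP y hyP fun h => hR ⟨y, hyR, h⟩
  refine ⟨SafeProjection.reattach T X L, fun b => collapse X L (Q b), hTree, fun b => ?_, ?_⟩
  · change b.1 ∈ (collapse X L (Q b)).1
    by_cases hb : Q b ∈ X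
    · rw [collapse_of_mem hb]
      exact hmemL _ hb _ (hQ b) fun h => mem_of_reachable_restrict h hxC (hBC b.2)
    · rw [collapse_of_notMem hb]
      exact hQ b
  -- Both ends of `e` contain `x`, so `e` lies inside `X` and is lost in the collapse, while the
  -- remaining path separators are images of old ones.
  · have heX : ∀ S ∈ e, S ∈ X := fun S hS => ⟨x, hxe S hS, SimpleGraph.Reachable.refl _⟩
    have hsub : pathSeparators (SafeProjection.reattach T X L) (fun b => collapse X L (Q b)) ⊆
        Sym2.map (collapse X L) '' (pathSeparators T Q \ {e}) := by
      rintro f ⟨b, c, p', hp', hf⟩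
      obtain ⟨p, hp⟩ := hT.isTree.connected.exists_isPath (Q b) (Q c)
      obtain ⟨q, hq⟩ := exists_walk_reattach hL p
      obtain ⟨g, hg, hgX, rfl⟩ := hq f (edges_subset_of_isPath hTree.isTree hp' q hf)
      exact ⟨g, ⟨⟨b, c, p, hp, hg⟩, fun h => hgX (h ▸ heX)⟩, rfl⟩
    calc _ ≤ (Sym2.map (collapse X L) '' (pathSeparators T Q \ {e})).ncard :=
          Set.ncard_le_ncard hsub (Set.toFinite _)
      _ ≤ (pathSeparators T Q \ {e}).ncard := Set.ncard_image_le (Set.toFinite _)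
      _ < _ := Set.ncard_sdiff_singleton_lt_of_mem he (Set.toFinite _)

end Exchange

/-! ### The least convex set containing `B` -/

section Hull

variable {A : Type*} [Finite A] [DecidableEq A] {G : SimpleGraph A}

/-- For some junction tree, the items of the inner separators of `B` are in each convex set
containing `B`. -/
theorem exists_isJunctionTree_isLeast (hconn : G.Connected) (htri : IsTriangulated G)
    (B : Finset A) :
    ∃ T : SimpleGraph (MaxClique G), IsJunctionTree G T ∧
      ∀ Q : B → MaxClique G, IsOptimalChoice T B Q →
        IsLeast {C : Set A | (B : Set A) ⊆ C ∧ IsConvex G C}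
          ((B : Set A) ∪ separatorItems (pathSeparators T Q)) := by
  obtain ⟨T₀, hT₀⟩ := exists_isJunctionTree hconn htri
  obtain ⟨Q₀, hQ₀, -⟩ := exists_isOptimalChoice T₀ B
  -- Minimise over trees and choices together. Any optimal choice for this `T` then attains the
  -- global minimum, so no exchange can improve it.
  obtain ⟨⟨T, Q⟩, ⟨hT, hQ⟩, hmin⟩ := Set.exists_min_image
    {TQ : SimpleGraph (MaxClique G) × (B → MaxClique G) |
      IsJunctionTree G TQ.1 ∧ IsCliqueChoice B TQ.2}
    (fun TQ => (pathSeparators TQ.1 TQ.2).ncard) (Set.toFinite _) ⟨(T₀, Q₀), hT₀, hQ₀⟩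
  refine ⟨T, hT, fun Q' hQ' =>
    ⟨⟨Set.subset_union_left, hT.isConvex_union_separatorItems hQ'.1⟩, ?_⟩⟩
  rintro C ⟨hBC, hC⟩
  refine Set.union_subset hBC fun x hx => ?_
  by_contra hxC
  obtain ⟨T'', Q'', hT'', hQ'', hlt⟩ :=
    hT.exists_fewer_pathSeparators htri hQ'.1 hC hBC hx hxC
  exact absurd (hlt.trans_le ((hQ'.2 Q hQ).trans (hmin (T'', Q'') ⟨hT'', hQ''⟩))) (lt_irrefl _)

end Hull

/-! ### Changing one coordinate -/

section Flip

variable {ι : Type*} [DecidableEq ι]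

/-- The involution changing the value at `w`. -/
def flip (w : ι) : Equiv.Perm (ι → Bool) :=
  Function.Involutive.toPerm (fun z => Function.update z w (!z w)) fun z => by simp

theorem flip_apply_self (w : ι) (z : ι → Bool) : flip w z w = !z w := by
  simp [flip, Function.Involutive.toPerm]

theorem flip_apply_of_ne {w i : ι} (h : i ≠ w) (z : ι → Bool) : flip w z i = z i := by
  simp [flip, Function.Involutive.toPerm, h]

theorem flip_flip (w : ι) (z : ι → Bool) : flip w (flip w z) = z :=
  Function.Involutive.toPerm_involutive _ z

theorem dependsOn_flip {β : Type*} {g : (ι → Bool) → β} {s : Set ι} (hg : DependsOn g s) {w : ι}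
    (hw : w ∉ s) (z : ι → Bool) : g (flip w z) = g z :=
  hg fun _ hi => flip_apply_of_ne (fun h => hw (by rwa [← h])) z

end Flip

/-! ### Redrawing one coordinate from a conditional law -/

section Resampling

variable {ι : Type*} [Fintype ι] [DecidableEq ι]

theorem indicator_dependsOn (U : Finset ι) : DependsOn (indicator U) (U : Set ι) := by
  intro z z' h
  unfold indicator
  exact if_congr (forall₂_congr fun i hi => by rw [h i hi]) rfl rfl

theorem indicator_nonneg (U : Finset ι) (z : ι → Bool) : 0 ≤ indicator U z := by
  unfold indicator; split_ifs <;> norm_num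

theorem indicator_union (U V : Finset ι) (z : ι → Bool) :
    indicator (U ∪ V) z = indicator U z * indicator V z := by
  unfold indicator
  simp only [Finset.mem_union, or_imp, forall_and, ite_and, ite_mul, one_mul, zero_mul]

/-- Functions of the items of `K` are linear combinations of indicators of subsets of `K`. -/
theorem sum_mul_eq_zero_of_frequency (K : Finset ι) : ∀ (d h : (ι → Bool) → ℝ),
    (∀ U ⊆ K, frequency d U = 0) → DependsOn h (K : Set ι) → ∑ z, d z * h z = 0 := by
  induction K using Finset.induction_on with
  | empty =>
    intro d h hd hh
    have h0 := hd ∅ (by simp)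
    have hconst : ∀ z, h z = h fun _ => false := fun z => hh (by simp)
    simp only [frequency, indicator, Finset.notMem_empty, false_imp_iff, implies_true, if_true,
      mul_one] at h0
    simp_rw [hconst, ← Finset.sum_mul, h0, zero_mul]
  | insert a K ha ih =>
    intro d h hd hh
    have hdep : ∀ b : Bool, DependsOn (fun z => h (Function.update z a b)) (K : Set ι) := by
      intro b z z' hz
      refine hh fun i hi => ?_
      by_cases hia : i = a
      · subst hia; simp
      · rw [Function.update_of_ne hia, Function.update_of_ne hia]
        exact hz i (by simpa [hia] using hi)
    have h1 := ih d (fun z => h (Function.update z a false))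
      (fun U hU => hd U (hU.trans (Finset.subset_insert _ _))) (hdep false)
    -- Write `h` as its value at `z a = false` plus `indicator {a}` times the difference of its two
    -- values. The induction hypothesis handles both terms, the second with the weight `d *
    -- indicator {a}`.
    have h2 := ih (fun z => d z * indicator {a} z)
      (fun z => h (Function.update z a true) - h (Function.update z a false))
      (fun U hU => by
        rw [← hd ({a} ∪ U) (by
          rw [← Finset.insert_eq]; exact Finset.insert_subset_insert a hU)]
        simp only [frequency, indicator_union, mul_assoc])
      (fun z z' hz => congrArg₂ (· - ·) (hdep true hz) (hdep false hz))
    rw [← add_zero (0 : ℝ)]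
    nth_rewrite 1 [← h1]
    rw [← h2, ← Finset.sum_add_distrib]
    refine Finset.sum_congr rfl fun z _ => ?_
    rcases hz : z a with _ | _
    · have hu : Function.update z a false = z := by rw [← hz]; simp
      simp [hu, indicator, hz]
    · have hu : Function.update z a true = z := by rw [← hz]; simp
      simp only [hu, indicator, Finset.mem_singleton, forall_eq, hz, if_true]
      ring

/-- The value at `w` is drawn again with probabilities `κ`. -/
def resample (w : ι) (κ p : (ι → Bool) → ℝ) (z : ι → Bool) : ℝ :=
  (p z + p (flip w z)) * κ z

/-- Substituting `flip w` moves the resampling from the distribution to the test function. -/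
theorem sum_resample_mul (w : ι) (κ p g : (ι → Bool) → ℝ) :
    ∑ z, resample w κ p z * g z =
      ∑ z, p z * (κ z * g z + κ (flip w z) * g (flip w z)) := by
  have h : ∑ z, p (flip w z) * (κ z * g z) = ∑ z, p z * (κ (flip w z) * g (flip w z)) := by
    rw [← Equiv.sum_comp (flip w)]
    simp only [flip_flip]
  calc _ = ∑ z, (p z * (κ z * g z) + p (flip w z) * (κ z * g z)) :=
        Finset.sum_congr rfl fun z _ => by unfold resample; ring
    _ = _ := by
        rw [Finset.sum_add_distrib, h, ← Finset.sum_add_distrib]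
        exact Finset.sum_congr rfl fun z _ => by ring

theorem sum_resample_mul_of_flip {w : ι} {κ : (ι → Bool) → ℝ}
    (hκ : ∀ z, κ z + κ (flip w z) = 1) (p : (ι → Bool) → ℝ) {g : (ι → Bool) → ℝ}
    (hg : ∀ z, g (flip w z) = g z) : ∑ z, resample w κ p z * g z = ∑ z, p z * g z := by
  rw [sum_resample_mul]
  refine Finset.sum_congr rfl fun z _ => ?_
  rw [hg, ← add_mul, hκ, one_mul]

/-- The probability under `p` of the values of `z` on `K`. -/
def cylinder (K : Finset ι) (p : (ι → Bool) → ℝ) (z : ι → Bool) : ℝ :=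
  ∑ y, if ∀ i ∈ K, y i = z i then p y else 0

theorem cylinder_dependsOn (K : Finset ι) (p : (ι → Bool) → ℝ) :
    DependsOn (cylinder K p) (K : Set ι) := by
  intro z z' h
  unfold cylinder
  refine Finset.sum_congr rfl fun y _ => ?_
  exact if_congr (forall₂_congr fun i hi => by rw [h i hi]) rfl rfl

theorem sum_mul_eq_of_cylinder {K : Finset ι} {p q : (ι → Bool) → ℝ}
    (h : ∀ z, cylinder K p z = cylinder K q z) {g : (ι → Bool) → ℝ}
    (hg : DependsOn g (K : Set ι)) : ∑ z, p z * g z = ∑ z, q z * g z := by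
  have key : ∀ p : (ι → Bool) → ℝ, ∑ z, p z * g z =
      ∑ a : K → Bool, ∑ z with (fun i : K => z i) = a, p z * g z := fun p =>
    (Finset.sum_fiberwise _ _ _).symm
  have hfib : ∀ (p : (ι → Bool) → ℝ) (z₀ : ι → Bool),
      ∑ z with (fun i : K => z i) = (fun i : K => z₀ i), p z * g z = cylinder K p z₀ * g z₀ := by
    intro p z₀
    rw [cylinder, Finset.sum_mul, Finset.sum_filter]
    refine Finset.sum_congr rfl fun z _ => ?_
    by_cases hz : ∀ i ∈ K, z i = z₀ i
    · rw [if_pos hz, if_pos (funext fun i : K => hz i.1 i.2), hg hz]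
    · rw [if_neg hz, if_neg fun h => hz fun i hi => congrFun h ⟨i, hi⟩, zero_mul]
  rw [key p, key q]
  refine Finset.sum_congr rfl fun a _ => ?_
  obtain ⟨z₀, rfl⟩ : ∃ z₀ : ι → Bool, (fun i : K => z₀ i) = a :=
    ⟨fun j => if hj : j ∈ K then a ⟨j, hj⟩ else false, by ext i; simp⟩
  rw [hfib, hfib, h]

theorem cylinder_flip {K : Finset ι} {w : ι} (p : (ι → Bool) → ℝ) (z : ι → Bool) :
    cylinder K (fun y => p (flip w y)) z = cylinder K p (flip w z) := by
  unfold cylinder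
  rw [← Equiv.sum_comp (flip w)]
  refine Finset.sum_congr rfl fun y _ => ?_
  simp only [flip_flip]
  refine if_congr (forall₂_congr fun i _ => ?_) rfl rfl
  by_cases hi : i = w
  · subst hi
    rw [flip_apply_self, flip_apply_self]
    cases y i <;> cases z i <;> simp
  · rw [flip_apply_of_ne hi, flip_apply_of_ne hi]

theorem cylinder_resample {K : Finset ι} {w : ι} {κ : (ι → Bool) → ℝ}
    (hκ : DependsOn κ (K : Set ι)) (p : (ι → Bool) → ℝ) (z : ι → Bool) :
    cylinder K (resample w κ p) z = (cylinder K p z + cylinder K p (flip w z)) * κ z := by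
  rw [← cylinder_flip]
  unfold cylinder
  rw [← Finset.sum_add_distrib, Finset.sum_mul]
  refine Finset.sum_congr rfl fun y _ => ?_
  by_cases hy : ∀ i ∈ K, y i = z i
  · rw [if_pos hy, if_pos hy, if_pos hy, resample, hκ hy]
  · rw [if_neg hy, if_neg hy, if_neg hy]; ring

/-- The conditional probabilities of the value at `w` under `p`, given the values on `K \ {w}`. -/
theorem exists_conditional_kernel {p : (ι → Bool) → ℝ} (hp : ∀ z, 0 ≤ p z) (K : Finset ι)
    (w : ι) :
    ∃ κ : (ι → Bool) → ℝ, (∀ z, 0 ≤ κ z) ∧ (∀ z, κ z + κ (flip w z) = 1) ∧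
      DependsOn κ (K : Set ι) ∧ ∀ g : (ι → Bool) → ℝ, DependsOn g (K : Set ι) →
        ∑ z, resample w κ p z * g z = ∑ z, p z * g z := by
  classical
  set N := cylinder K p with hN
  have hN0 : ∀ z, 0 ≤ N z := fun z => Finset.sum_nonneg fun y _ => by
    split_ifs
    exacts [hp y, le_rfl]
  have hNdep : DependsOn N (K : Set ι) := cylinder_dependsOn K p
  have hNflip : DependsOn (fun z => N (flip w z)) (K : Set ι) := by
    intro z z' h
    refine hNdep fun i hi => ?_
    by_cases hiw : i = w
    · subst hiw
      rw [flip_apply_self, flip_apply_self, h i hi]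
    · rw [flip_apply_of_ne hiw, flip_apply_of_ne hiw, h i hi]
  -- Where the conditioning event has mass zero, `1 / 2` is a convenient nonnegative value that
  -- still sums to one with its flip.
  set κ : (ι → Bool) → ℝ := fun z =>
    if N z + N (flip w z) = 0 then 1 / 2 else N z / (N z + N (flip w z)) with hκ
  have hκdep : DependsOn κ (K : Set ι) := by
    intro z z' h
    have h1 := hNdep h
    have h2 : N (flip w z) = N (flip w z') := hNflip h
    simp only [hκ, h1, h2]
  refine ⟨κ, fun z => ?_, fun z => ?_, hκdep, fun g hg => sum_mul_eq_of_cylinder (fun z => ?_) hg⟩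
  · simp only [hκ]
    split_ifs
    · norm_num
    · exact div_nonneg (hN0 z) (add_nonneg (hN0 z) (hN0 _))
  · simp only [hκ, flip_flip]
    rw [add_comm (N (flip w z)) (N z)]
    split_ifs with h
    · norm_num
    · rw [← add_div, div_self h]
  · rw [cylinder_resample hκdep, ← hN]
    simp only [hκ]
    split_ifs with h
    · have h1 := hN0 z
      have h2 := hN0 (flip w z)
      rw [h, zero_mul]
      linarith
    · rw [mul_div_cancel₀ _ h]

/-- If `r` and `p` agree on `K`, then the value of `r` at `w` can be redrawn so that they agree on
`K ∪ {w}`. -/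
theorem exists_extend_frequency {p r : (ι → Bool) → ℝ} (hp : p ∈ distributions ι)
    (hr : r ∈ distributions ι) {K : Finset ι} {w : ι}
    (h : ∀ U ⊆ K, frequency r U = frequency p U) :
    ∃ r' ∈ distributions ι,
      (∀ g : (ι → Bool) → ℝ, (∀ z, g (flip w z) = g z) → ∑ z, r' z * g z = ∑ z, r z * g z) ∧
      ∀ U ⊆ insert w K, frequency r' U = frequency p U := by
  obtain ⟨κ, hκ0, hκ1, hκdep, hκp⟩ := exists_conditional_kernel hp.1 (insert w K) w
  refine ⟨resample w κ r, ⟨fun z => mul_nonneg (add_nonneg (hr.1 _) (hr.1 _)) (hκ0 z), ?_⟩,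
    fun g hg => sum_resample_mul_of_flip hκ1 r hg, fun U hU => ?_⟩
  · have := sum_resample_mul_of_flip hκ1 r (g := fun _ => 1) fun _ => rfl
    simp only [mul_one] at this
    rw [this, hr.2]
  · have hUdep : DependsOn (indicator U) ((insert w K : Finset ι) : Set ι) := fun z z' hz =>
      indicator_dependsOn U fun i hi => hz i (hU hi)
    rw [frequency, frequency, ← hκp _ hUdep, sum_resample_mul, sum_resample_mul, ← sub_eq_zero,
      ← Finset.sum_sub_distrib]
    simp only [← sub_mul]
    -- Under the common kernel, both frequencies integrate the same function, from which the value
    -- at `w` has been summed out. It depends on `K` only, where `r` and `p` agree; changing the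
    -- value at `w` merely swaps its two summands.
    refine sum_mul_eq_zero_of_frequency K (fun z => r z - p z) _ (fun V hV => ?_) ?_
    · simp only [frequency, sub_mul, Finset.sum_sub_distrib]
      exact sub_eq_zero.mpr (h V hV)
    · intro z z' hz
      have hdep : DependsOn (fun z => κ z * indicator U z) ((insert w K : Finset ι) : Set ι) :=
        fun z z' hz => congrArg₂ (· * ·) (hκdep hz) (hUdep hz)
      by_cases hw : z w = z' w
      · have h1 : κ z * indicator U z = κ z' * indicator U z' := hdep fun i hi => by
          rcases Finset.mem_insert.mp hi with rfl | hi
          exacts [hw, hz i hi]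
        have h2 : κ (flip w z) * indicator U (flip w z) =
            κ (flip w z') * indicator U (flip w z') := hdep fun i hi => by
          by_cases hiw : i = w
          · subst hiw; rw [flip_apply_self, flip_apply_self, hw]
          · rw [flip_apply_of_ne hiw, flip_apply_of_ne hiw]
            exact hz i ((Finset.mem_insert.mp hi).resolve_left hiw)
        simp only [h1, h2]
      · have h1 : κ z * indicator U z = κ (flip w z') * indicator U (flip w z') :=
          hdep fun i hi => by
            by_cases hiw : i = w
            · subst hiw
              rw [flip_apply_self]
              revert hw; cases z i <;> cases z' i <;> simp
            · rw [flip_apply_of_ne hiw]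
              exact hz i ((Finset.mem_insert.mp hi).resolve_left hiw)
        have h2 : κ (flip w z) * indicator U (flip w z) = κ z' * indicator U z' :=
          hdep fun i hi => by
            by_cases hiw : i = w
            · subst hiw
              rw [flip_apply_self]
              revert hw; cases z i <;> cases z' i <;> simp
            · rw [flip_apply_of_ne hiw]
              exact hz i ((Finset.mem_insert.mp hi).resolve_left hiw)
        simp only [h1, h2]
        ring

end Resampling

/-! ### Marginals and projected frequencies -/

section Marginals

variable {A : Type*}

theorem mem_lift {C : Finset A} {V : Finset C} {x : A} :
    x ∈ lift C V ↔ ∃ h : x ∈ C, (⟨x, h⟩ : C) ∈ V := by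
  simp [lift]

theorem lift_subset (C : Finset A) (V : Finset C) : lift C V ⊆ C := fun _ hx =>
  (mem_lift.mp hx).1

variable [DecidableEq A]

theorem exists_lift_eq {C U : Finset A} (h : U ⊆ C) : ∃ V : Finset C, lift C V = U :=
  ⟨U.subtype (· ∈ C), by ext x; rw [mem_lift]; simp; exact fun hx => h hx⟩

variable [Fintype A]

theorem marginal_apply (C : Finset A) (p : (A → Bool) → ℝ) (y : C → Bool) :
    marginal C p y = ∑ z, p z * if (fun a : C => z a) = y then 1 else 0 := by
  unfold marginal
  rw [Finset.sum_filter]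
  simp

theorem sum_marginal_mul (C : Finset A) (p : (A → Bool) → ℝ) (g : (C → Bool) → ℝ) :
    ∑ y, marginal C p y * g y = ∑ z, p z * g fun a : C => z a := by
  unfold marginal
  rw [← Finset.sum_fiberwise Finset.univ (fun z : A → Bool => fun a : C => z a)]
  refine Finset.sum_congr rfl fun y _ => ?_
  rw [Finset.sum_mul]
  refine Finset.sum_congr rfl fun z hz => ?_
  rw [(Finset.mem_filter.mp hz).2]

theorem indicator_lift (C : Finset A) (V : Finset C) (z : A → Bool) :
    indicator V (fun a : C => z a) = indicator (lift C V) z := by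
  unfold indicator
  refine if_congr ⟨fun h x hx => ?_, fun h i hi => h i (mem_lift.mpr ⟨i.2, hi⟩)⟩ rfl rfl
  obtain ⟨hxC, hxV⟩ := mem_lift.mp hx
  exact h ⟨x, hxC⟩ hxV

theorem frequency_marginal (C : Finset A) (p : (A → Bool) → ℝ) (V : Finset C) :
    frequency (marginal C p) V = frequency p (lift C V) := by
  unfold frequency
  rw [sum_marginal_mul]
  simp only [indicator_lift]

theorem marginal_mem_distributions (C : Finset A) {p : (A → Bool) → ℝ}
    (hp : p ∈ distributions A) : marginal C p ∈ distributions C := by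
  refine ⟨fun y => Finset.sum_nonneg fun z _ => hp.1 z, ?_⟩
  have := sum_marginal_mul C p fun _ => 1
  simp only [mul_one] at this
  rw [this, hp.2]

/-- Every distribution on `C` is a marginal. -/
theorem exists_marginal_eq (C : Finset A) {q : (C → Bool) → ℝ} (hq : q ∈ distributions C) :
    ∃ r ∈ distributions A, marginal C r = q := by
  -- The value `false` outside `C` is arbitrary; any fixed extension would do.
  set ext : (C → Bool) → A → Bool := fun y a => if h : a ∈ C then y ⟨a, h⟩ else false with hext
  have hres : ∀ y, (fun a : C => ext y a) = y := fun y => by ext a; simp [hext]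
  have hr : ∀ z, 0 ≤ ∑ y, if ext y = z then q y else 0 := fun z =>
    Finset.sum_nonneg fun y _ => by
      split_ifs
      exacts [hq.1 y, le_rfl]
  have hsum : ∀ g : (A → Bool) → ℝ,
      ∑ z, (∑ y, if ext y = z then q y else 0) * g z = ∑ y, q y * g (ext y) := by
    intro g
    simp only [Finset.sum_mul]
    rw [Finset.sum_comm]
    refine Finset.sum_congr rfl fun y _ => ?_
    simp [ite_mul]
  refine ⟨fun z => ∑ y, if ext y = z then q y else 0, ⟨hr, ?_⟩, ?_⟩
  · have := hsum fun _ => 1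
    simp only [mul_one] at this
    rw [this, hq.2]
  · ext y
    rw [marginal_apply, hsum]
    simp [hres]

end Marginals

/-! ### Safe sets are exactly the convex sets -/

section SafeSets

variable {A : Type*} [DecidableEq A] {F : Set (Finset A)}

theorem isClique_of_mem (hanti : IsLowerSet F) {U : Finset A} (hU : U ∈ F) :
    (dependencyGraph F).IsClique (U : Set A) := by
  intro x hx y hy hne
  exact ⟨hne, hanti (Finset.insert_subset hx (Finset.singleton_subset_iff.mpr hy)) hU⟩

variable [Fintype A]

/-- A distribution with the right frequencies on a convex set extends to all items. -/
theorem exists_extension_of_isConvex (hanti : IsLowerSet F)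
    (htri : IsTriangulated (dependencyGraph F)) (hsafe : IsCliqueSafe F)
    {p : (A → Bool) → ℝ} (hp : p ∈ distributions A) (n : ℕ) :
    ∀ C : Finset A, Cᶜ.card = n → IsConvex (dependencyGraph F) (C : Set A) →
      ∀ r ∈ distributions A, (∀ U ∈ F, U ⊆ C → frequency r U = frequency p U) →
      ∃ p' ∈ distributions A,
        (∀ g : (A → Bool) → ℝ, DependsOn g (C : Set A) → ∑ z, p' z * g z = ∑ z, r z * g z) ∧
        ∀ U ∈ F, frequency p' U = frequency p U := by
  induction n with
  | zero =>
    intro C hcard _ r hr h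
    have hC : C = Finset.univ := by simpa using hcard
    subst hC
    exact ⟨r, hr, fun _ _ => rfl, fun U hU => h U hU (Finset.subset_univ U)⟩
  | succ n ih =>
    intro C hcard hC r hr h
    obtain ⟨w₀, hw₀⟩ : Cᶜ.Nonempty := Finset.card_pos.mp (by omega)
    have hw₀C : w₀ ∉ (C : Set A) := by simpa using hw₀
    obtain ⟨w, hw₀w, hadj⟩ := htri.exists_adj_attachment hC hw₀C
    have hwC' : w ∉ (C : Set A) := mem_of_reachable_restrict hw₀w hw₀C
    have hwC : w ∉ C := hwC'
    rw [attachment_congr hw₀w] at hadj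
    obtain ⟨K, hK⟩ : ∃ K : Finset A, (K : Set A) = attachment (dependencyGraph F) C w :=
      (Set.toFinite _).exists_finset_coe
    have hKC : K ⊆ C := fun x hx => by
      have hx' : x ∈ (K : Set A) := hx
      rw [hK] at hx'
      exact hx'.1
    have hwK : w ∉ K := fun h => hwC (hKC h)
    have hclique : (dependencyGraph F).IsClique ((insert w K : Finset A) : Set A) := by
      rw [Finset.coe_insert, hK]
      exact (hC.isClique_attachment hwC').insert fun b hb _ => (hadj b hb).symm
    obtain ⟨M, hM⟩ := exists_maxClique_superset hclique
    -- Clique-safety enters here: `K` misses `w`, so it is a proper subset of `M`. The clique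
    -- `insert w K` itself need not belong to `F`.
    have hKF : K ∈ F := by
      refine hsafe M K ⟨fun x hx => hM (by simp [hx]), fun h => hwK (h (hM (by simp)))⟩
    have hKY : attachment (dependencyGraph F) C w ⊆ ((insert w K : Finset A) : Set A) := by
      rw [Finset.coe_insert, hK]; exact Set.subset_insert _ _
    have hYW : ∀ y ∈ ((insert w K : Finset A) : Set A),
        y ∈ attachment (dependencyGraph F) C w ∨
          (restrict (dependencyGraph F) (C : Set A)ᶜ).Reachable w y := by
      intro y hy
      rw [Finset.coe_insert, hK] at hy
      rcases hy with rfl | hy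
      exacts [Or.inr (SimpleGraph.Reachable.refl _), Or.inl hy]
    have hunion : ((insert w C : Finset A) : Set A) = (C : Set A) ∪ (insert w K : Finset A) := by
      ext x
      have := @hKC x
      simp only [Finset.coe_insert, Set.mem_insert_iff, Set.mem_union, Finset.mem_coe]
      tauto
    -- Redrawing `w` leaves everything on `C` unchanged and matches `p` on `insert w K`. Members of
    -- `F` inside `insert w C` are cliques, so each lies in one of these two sets.
    obtain ⟨r', hr', hr'r, hr'p⟩ := exists_extend_frequency hp hr (K := K) (w := w)
      fun U hU => h U (hanti hU hKF) (hU.trans hKC)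
    obtain ⟨p', hp', hp'r, hp'p⟩ := ih (insert w C)
      (by
        rw [Finset.card_compl, Finset.card_insert_of_notMem hwC]
        rw [Finset.card_compl] at hcard
        omega)
      (by rw [hunion]; exact hC.union_clique hwC' hclique hKY hYW) r' hr'
      (by
        intro U hU hUC
        have hUC' : (U : Set A) ⊆ (C : Set A) ∪ (insert w K : Finset A) := by
          rw [← hunion]; exact Finset.coe_subset.mpr hUC
        rcases clique_subset_or_subset_of_union hwC' hKY hYW (isClique_of_mem hanti hU) hUC'
          with hsub | hsub
        · rw [← h U hU (Finset.coe_subset.mp hsub)]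
          exact hr'r _ fun z => dependsOn_flip (indicator_dependsOn U) (fun hw => hwC' (hsub hw)) z
        · exact hr'p U (Finset.coe_subset.mp hsub))
    refine ⟨p', hp', fun g hg => ?_, hp'p⟩
    rw [hp'r g fun z z' hz => hg fun i hi => hz i (Finset.mem_insert_of_mem hi)]
    exact hr'r g fun z => dependsOn_flip hg hwC' z

theorem isSafe_of_isConvex (hanti : IsLowerSet F) (htri : IsTriangulated (dependencyGraph F))
    (hsafe : IsCliqueSafe F) {C : Finset A} (hC : IsConvex (dependencyGraph F) (C : Set A)) :
    IsSafe F C := by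
  rintro θ ⟨p, hp, hpθ⟩ q hq hqθ
  obtain ⟨r, hr, rfl⟩ := exists_marginal_eq C hq
  obtain ⟨p', hp', hp'r, hp'p⟩ := exists_extension_of_isConvex hanti htri hsafe hp _ C rfl hC r hr
    fun U hU hUC => by
      obtain ⟨V, rfl⟩ := exists_lift_eq hUC
      rw [← frequency_marginal, hqθ V hU, hpθ _ hU, projFreq]
  refine ⟨p', hp', ?_, fun U hU => (hp'p U hU).trans (hpθ U hU)⟩
  ext y
  rw [marginal_apply, marginal_apply]
  refine hp'r _ fun z z' hz => ?_
  exact if_congr (by rw [show (fun a : C => z a) = fun a : C => z' a from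
    funext fun a => hz a.1 a.2]) rfl rfl

/-- The uniform mixture of the point masses at the characteristic functions of `S` and `S'`. -/
noncomputable def pairMixture (S S' : Finset A) (z : A → Bool) : ℝ :=
  ((if z = fun i => decide (i ∈ S) then 1 else 0) +
    if z = fun i => decide (i ∈ S') then 1 else 0) / 2

theorem sum_pairMixture_mul (S S' : Finset A) (g : (A → Bool) → ℝ) :
    ∑ z, pairMixture S S' z * g z =
      (g (fun i => decide (i ∈ S)) + g fun i => decide (i ∈ S')) / 2 := by
  simp only [pairMixture, div_mul_eq_mul_div, add_mul, ite_mul, one_mul, zero_mul]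
  rw [← Finset.sum_div, Finset.sum_add_distrib]
  simp

theorem pairMixture_mem_distributions (S S' : Finset A) :
    pairMixture S S' ∈ distributions A := by
  refine ⟨fun z => by unfold pairMixture; positivity, ?_⟩
  have := sum_pairMixture_mul S S' fun _ => 1
  simpa using this

theorem frequency_pairMixture (S S' U : Finset A) :
    frequency (pairMixture S S') U =
      ((if U ⊆ S then 1 else 0) + if U ⊆ S' then 1 else 0) / 2 := by
  rw [frequency, sum_pairMixture_mul]
  simp [indicator, Finset.subset_iff]

/-- If the frequencies of `{a}` and `{a, b}` are equal, then `b` is present whenever `a` is. -/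
theorem eq_true_of_frequency_eq {p : (A → Bool) → ℝ} (hp : ∀ z, 0 ≤ p z) {a b : A}
    (h : frequency p {a} = frequency p {a, b}) {z : A → Bool} (hz : p z ≠ 0) (ha : z a = true) :
    z b = true := by
  have hle : ∀ z, indicator {a, b} z ≤ indicator {a} z := by
    intro z
    rw [Finset.insert_eq, indicator_union]
    refine mul_le_of_le_one_right (indicator_nonneg _ _) ?_
    unfold indicator; split_ifs <;> norm_num
  have hsum : ∑ z, p z * (indicator {a} z - indicator {a, b} z) = 0 := by
    simp only [mul_sub, Finset.sum_sub_distrib]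
    exact sub_eq_zero.mpr h
  have h0 := (Finset.sum_eq_zero_iff_of_nonneg fun z _ =>
    mul_nonneg (hp z) (sub_nonneg.mpr (hle z))).mp hsum z (Finset.mem_univ z)
  have h1 := (mul_eq_zero.mp h0).resolve_left hz
  by_contra hb
  simp [indicator, ha, hb] at h1

/-- Suppose `x` and `y` are nonadjacent but attached to one component. Take frequencies from the
mixture of `S = {x, y} ∪ Cᶜ` and `∅`, and on `C` the mixture of `{x}` and `{y}`; as `{x, y} ∉ F`,
the two agree on the members of `F` inside `C`. In an extension, adjacent `a, b ∈ S` have equal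
frequencies of `{a}` and `{a, b}`, so presence of `x` spreads through the component to `y`. But on
`C` the two items never occur together, while `x` has frequency `1 / 2`. -/
theorem isConvex_of_isSafe (hanti : IsLowerSet F) {C : Finset A} (hC : IsSafe F C) :
    IsConvex (dependencyGraph F) (C : Set A) := by
  intro x y u v hx hy hu hv hxu hyv huv hne
  by_contra hxy
  have hxyF : ({x, y} : Finset A) ∉ F := fun h => hxy ⟨hne, h⟩
  set S : Finset A := {x, y} ∪ Cᶜ with hS
  have hsub : ∀ U ∈ F, U ⊆ C →
      frequency (pairMixture {x} {y}) U = frequency (pairMixture S ∅) U := by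
    intro U hU hUC
    have h1 : U ⊆ S ↔ U ⊆ {x, y} := by
      refine ⟨fun h a ha => ?_, fun h => h.trans Finset.subset_union_left⟩
      rcases Finset.mem_union.mp (h ha) with h' | h'
      · exact h'
      · exact absurd (hUC ha) (Finset.mem_compl.mp h')
    rw [frequency_pairMixture, frequency_pairMixture]
    simp only [h1]
    by_cases hxU : x ∈ U <;> by_cases hyU : y ∈ U
    · exact absurd (hanti (Finset.insert_subset hxU (Finset.singleton_subset_iff.mpr hyU)) hU) hxyF
    all_goals
      simp only [Finset.subset_iff, Finset.mem_insert, Finset.mem_singleton, Finset.notMem_empty]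
      congr 1
      grind
  obtain ⟨p, hp, hmarg, hpθ⟩ := hC (frequency (pairMixture S ∅))
    ⟨_, pairMixture_mem_distributions S ∅, fun _ _ => rfl⟩ (marginal C (pairMixture {x} {y}))
    (marginal_mem_distributions C (pairMixture_mem_distributions _ _)) fun V hV => by
      rw [frequency_marginal]
      exact hsub _ hV (lift_subset C V)
  have hstep : ∀ {a b : A}, (dependencyGraph F).Adj a b → a ∈ S → b ∈ S → ∀ {z}, p z ≠ 0 →
      z a = true → z b = true := by
    intro a b hab ha hb z hz hza
    have haF : ({a} : Finset A) ∈ F := hanti (by simp) hab.2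
    refine eq_true_of_frequency_eq hp.1 ?_ hz hza
    rw [hpθ _ haF, hpθ _ hab.2, frequency_pairMixture, frequency_pairMixture]
    simp [Finset.insert_subset_iff, ha, hb]
  have hCS : ∀ a ∈ (C : Set A)ᶜ, a ∈ S := fun a ha =>
    Finset.mem_union_right _ (Finset.mem_compl.mpr ha)
  have hxS : x ∈ S := Finset.mem_union_left _ (by simp)
  have hyS : y ∈ S := Finset.mem_union_left _ (by simp)
  have hwalk : ∀ z, p z ≠ 0 → z u = true → z v = true := by
    intro z hz
    obtain ⟨w⟩ := huv
    clear hu hxu hv hyv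
    induction w with
    | nil => exact id
    | cons hadj w ih =>
      exact fun h => ih (hstep hadj.1 (hCS _ hadj.2.1) (hCS _ hadj.2.2) hz h)
  have hend : ∀ z, p z ≠ 0 → z x = true → z y = true := fun z hz h =>
    hstep hyv.symm (hCS v hv) hyS hz (hwalk z hz (hstep hxu hxS (hCS u hu) hz h))
  have hfreq : frequency p {x, y} = frequency p {x} := by
    unfold frequency
    refine Finset.sum_congr rfl fun z _ => ?_
    by_cases hz : p z = 0
    · rw [hz, zero_mul, zero_mul]
    · congr 1
      simp only [indicator, Finset.mem_insert, Finset.mem_singleton, forall_eq_or_imp, forall_eq]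
      exact if_congr ⟨fun h => h.1, fun h => ⟨h, hend z hz h⟩⟩ rfl rfl
  have hC' : ∀ U ⊆ C, frequency p U = frequency (pairMixture {x} {y}) U := by
    intro U hU
    obtain ⟨V, rfl⟩ := exists_lift_eq hU
    rw [← frequency_marginal, ← frequency_marginal, hmarg]
  rw [hC' _ (Finset.insert_subset hx (Finset.singleton_subset_iff.mpr hy)),
    hC' _ (Finset.singleton_subset_iff.mpr hx), frequency_pairMixture,
    frequency_pairMixture] at hfreq
  have h1 : ¬ ({x, y} : Finset A) ⊆ {x} := fun h => hne.symm (by simpa using @h y)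
  have h2 : ¬ ({x, y} : Finset A) ⊆ {y} := fun h => hne (by simpa using @h x)
  rw [if_neg h1, if_neg h2, if_pos (Finset.Subset.refl _)] at hfreq
  split_ifs at hfreq <;> norm_num at hfreq

end SafeSets

end SafeProjection

theorem theorem8 {A : Type*} [Fintype A] [DecidableEq A] (F : Set (Finset A))
    (hanti : IsLowerSet F)
    (hconn : (dependencyGraph F).Connected)
    (htri : IsTriangulated (dependencyGraph F))
    (hsafe : IsCliqueSafe F)
    (B : Finset A) :
    ∃ C : Finset A, IsMinimalSafe F B C ∧
      ∃ T : SimpleGraph (MaxClique (dependencyGraph F)),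
        IsJunctionTree (dependencyGraph F) T ∧
        ∀ Q : B → MaxClique (dependencyGraph F), IsOptimalChoice T B Q →
          (C : Set A) = (B : Set A) ∪ separatorItems (pathSeparators T Q) := by
  obtain ⟨T, hT, hleast⟩ := exists_isJunctionTree_isLeast hconn htri B
  obtain ⟨Q₀, hQ₀⟩ := exists_isOptimalChoice T B
  obtain ⟨C, hC⟩ : ∃ C : Finset A,
      (C : Set A) = (B : Set A) ∪ separatorItems (pathSeparators T Q₀) :=
    (Set.toFinite _).exists_finset_coe
  have hCleast := hleast Q₀ hQ₀
  rw [← hC] at hCleast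
  -- The set is built from one optimal choice; uniqueness of least elements gives the same set for
  -- all others.
  refine ⟨C, ⟨⟨Finset.coe_subset.mp hCleast.1.1,
    isSafe_of_isConvex hanti htri hsafe hCleast.1.2⟩, ?_⟩, T, hT,
    fun Q hQ => hCleast.unique (hleast Q hQ)⟩
  rintro Y ⟨hBY, hY⟩
  exact Finset.coe_subset.mp
    (hCleast.2 ⟨Finset.coe_subset.mpr hBY, isConvex_of_isSafe hanti hY⟩)
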